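/- **Theorem (lower bound for uniform-query key agreement).** *Setting.* Let $S$ be a finite set, $R$ a finite non-empty set of oracle answers (for example $R=\{0,1\}^n$), and let $\mathcal F_{S}$ be the family of all functions $f:S\to R$. A non-adaptive oracle-aided two-party protocol $\Pi=(\mathsf A,\mathsf B)$ consists of two parties with independent private coins; each party chooses its set of oracle queries from its coins alone before the interaction starts, receives the values of $f$ on these queries, and then the parties exchange bits, where the bits exchanged so far determine whether the protocol has ended and, if not, who sends the next bit; at the end each party outputs one bit. $\Pi$ is *$\ell$-uniform-query* if, for some fixed set $D\subseteq S$, the query set of each party is a uniformly random $\ell$-element subset of $D$. The communication complexity $\mathrm{CC}(\Pi)$ is the maximal number of bits exchanged in an execution. For $q\in\mathbb N$ and $0\le\alpha,\gamma\le 1$, $\Pi$ is a *$(q,\alpha,\gamma)$-key-agreement protocol relative to $\mathcal F_S$* if * (accuracy) for every $f\in\mathcal F_S$, the outputs of $\mathsf A$ and $\mathsf B$ in a random execution with oracle $f$ are equal with probability at least $1-\alpha$; and * (secrecy) for every algorithm $\mathsf E$ that gets the transcript and makes at most $q$ (adaptive) queries to $f$, the output of $\mathsf E$ equals that of $\mathsf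 A$ with probability at most $\gamma$, where $f$ is uniform in $\mathcal F_S$ and the execution is random. *Statement.* (1) There is a universal constant $c>0$ such that for all $S$, $R$, all integers $\ell\ge 1$ and $q\ge 0$, all $\alpha,\gamma\ge 0$ with $\alpha+\gamma<1$, and every $\ell$-uniform-query $(q,\alpha,\gamma)$-key-agreement protocol $\Pi$ relative to $\mathcal F_S$, $$\max\{1,\mathrm{CC}(\Pi)\}\;\ge\; c\cdot\frac{(1-\alpha-\gamma)^4\,q^2}{\ell^3}.$$ In particular $\mathrm{CC}(\Pi)\ge c\,(1-\alpha-\gamma)^4q^2/\ell^3$ whenever at least one bit is communicated in some execution. (2) Consequently, for all $\beta,\delta>0$ there are $c>0$ and $\ell_0$ such that every $\ell$-uniform-query $(q,\alpha,\gamma)$-key-agreement protocol $\Pi$ relative to $\mathcal F_S$ with $\ell\ge\ell_0$, $1-\alpha-\gamma\ge\delta$ and $q\ge\beta\ell^2$ satisfies $\mathrm{CC}(\Pi)\ge c\,\ell$. -/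

import Mathlib

universe u₁ u₂ u₃ u₄

namespace KeyAgreement

/-- The probability of the event `E` under the discrete distribution `p`. -/
noncomputable def prob {Ω : Type*} (p : PMF Ω) (E : Set Ω) : ℝ :=
  (p.toOuterMeasure E).toReal

/-- The independent product of two discrete distributions. -/
noncomputable def indep {Ω₁ Ω₂ : Type*} (p : PMF Ω₁) (p' : PMF Ω₂) : PMF (Ω₁ × Ω₂) :=
  p.bind fun a => p'.map fun b => (a, b)

/-- A two-party communication protocol with Boolean outputs, in the standard (protocol tree)
model. `U` and `V` are the types of the local data of `A` and `B`. At each node the party whose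
turn it is, which is determined by the bits exchanged so far, sends one bit computed from its
local data (and the bits exchanged so far, i.e. the node); at a leaf each party computes its
output bit from its local data (and the transcript, i.e. the leaf). -/
inductive Interaction (U : Type*) (V : Type*) where
  | output (outA : U → Bool) (outB : V → Bool) : Interaction U V
  | sendA (msg : U → Bool) (next : Bool → Interaction U V) : Interaction U V
  | sendB (msg : V → Bool) (next : Bool → Interaction U V) : Interaction U V

namespace Interaction

variable {U V : Type*}

/-- The transcript: the list of bits exchanged on local data `u`, `v`. -/
def transcript : Interaction U V → U → V → List Bool
  | output _ _, _, _ => []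
  | sendA msg next, u, v => msg u :: (next (msg u)).transcript u v
  | sendB msg next, u, v => msg v :: (next (msg v)).transcript u v

/-- The output of `A`. -/
def outA : Interaction U V → U → V → Bool
  | output oA _, u, _ => oA u
  | sendA msg next, u, v => (next (msg u)).outA u v
  | sendB msg next, u, v => (next (msg v)).outA u v

/-- The output of `B`. -/
def outB : Interaction U V → U → V → Bool
  | output _ oB, _, v => oB v
  | sendA msg next, u, v => (next (msg u)).outB u v
  | sendB msg next, u, v => (next (msg v)).outB u v

theorem exists_length_transcript_le (T : Interaction U V) :
    ∃ n : ℕ, ∀ u v, (T.transcript u v).length ≤ n := by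
  induction T with
  | output _ _ => exact ⟨0, fun _ _ => by simp [transcript]⟩
  | sendA msg next ih =>
    choose n hn using ih
    refine ⟨max (n true) (n false) + 1, fun u v => ?_⟩
    have h := hn (msg u) u v
    simp only [transcript, List.length_cons]
    cases hb : msg u <;> rw [hb] at h <;> omega
  | sendB msg next ih =>
    choose n hn using ih
    refine ⟨max (n true) (n false) + 1, fun u v => ?_⟩
    have h := hn (msg v) u v
    simp only [transcript, List.length_cons]
    cases hb : msg v <;> rw [hb] at h <;> omega

end Interaction

/-- A non-adaptive oracle-aided two-party protocol, for oracles `f : S → R`. The parties have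
independent private coins, and each party determines its set of oracle queries from its coins
alone, before the interaction starts. The local data of a party is then its coins together with
the oracle answers to its queries. -/
structure NonAdaptiveProtocol (S R ΩA ΩB : Type*) where
  coinsA : PMF ΩA
  coinsB : PMF ΩB
  queriesA : ΩA → Finset S
  queriesB : ΩB → Finset S
  interaction : Interaction ((r : ΩA) × (queriesA r → R)) ((r : ΩB) × (queriesB r → R))

/-- A (deterministic, adaptive) oracle-aided algorithm with Boolean output: a decision tree whose
inner nodes are oracle queries. -/
inductive OracleAlgorithm (S : Type*) (R : Type*) where
  | answer (b : Bool) : OracleAlgorithm S R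
  | query (x : S) (next : R → OracleAlgorithm S R) : OracleAlgorithm S R

namespace OracleAlgorithm

variable {S R : Type*}

/-- The output when run with oracle `f`. -/
def eval (f : S → R) : OracleAlgorithm S R → Bool
  | answer b => b
  | query x next => (next (f x)).eval f

/-- The number of oracle queries made when run with oracle `f`. -/
def numQueries (f : S → R) : OracleAlgorithm S R → ℕ
  | answer _ => 0
  | query x next => (next (f x)).numQueries f + 1

end OracleAlgorithm

namespace NonAdaptiveProtocol

variable {S R ΩA ΩB : Type*} (P : NonAdaptiveProtocol S R ΩA ΩB)

/-- The distribution of the pair of the parties' private coins. -/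
noncomputable def coins : PMF (ΩA × ΩB) :=
  indep P.coinsA P.coinsB

/-- The local data of `A` with coins `r` and oracle `f`. -/
def dataA (f : S → R) (r : ΩA) : (r : ΩA) × (P.queriesA r → R) :=
  ⟨r, fun x => f x⟩

/-- The local data of `B` with coins `r` and oracle `f`. -/
def dataB (f : S → R) (r : ΩB) : (r : ΩB) × (P.queriesB r → R) :=
  ⟨r, fun x => f x⟩

/-- The transcript of the execution with oracle `f` and coins `r`. -/
def trans (f : S → R) (r : ΩA × ΩB) : List Bool :=
  P.interaction.transcript (P.dataA f r.1) (P.dataB f r.2)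

/-- The output of `A` in the execution with oracle `f` and coins `r`. -/
def outA (f : S → R) (r : ΩA × ΩB) : Bool :=
  P.interaction.outA (P.dataA f r.1) (P.dataB f r.2)

/-- The output of `B` in the execution with oracle `f` and coins `r`. -/
def outB (f : S → R) (r : ΩA × ΩB) : Bool :=
  P.interaction.outB (P.dataA f r.1) (P.dataB f r.2)

/-- The lengths of the transcripts of all possible executions. -/
def transcriptLengths : Set ℕ :=
  {n | ∃ f : S → R, ∃ r ∈ P.coins.support, n = (P.trans f r).length}

/-- The communication complexity: the worst-case length of the transcript. -/
noncomputable def CC : ℕ := sSup P.transcriptLengths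

theorem bddAbove_transcriptLengths : BddAbove P.transcriptLengths := by
  obtain ⟨n, hn⟩ := P.interaction.exists_length_transcript_le
  refine ⟨n, ?_⟩
  rintro _ ⟨f, r, -, rfl⟩
  exact hn _ _

/-- `P` is an `ℓ`-uniform-query protocol with query domain `D`: the query set of each party is a
uniformly random `ℓ`-element subset of `D`. (The two query sets are independent, since the
parties' coins are.) -/
def IsUniformQuery (D : Finset S) (ℓ : ℕ) : Prop :=
  ∃ h : (D.powersetCard ℓ).Nonempty,
    P.coinsA.map P.queriesA = PMF.uniformOfFinset (D.powersetCard ℓ) h ∧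
    P.coinsB.map P.queriesB = PMF.uniformOfFinset (D.powersetCard ℓ) h

/-- `P` is a `(q, α, γ)`-key-agreement protocol relative to the family of all functions
`S → R`. -/
structure IsKeyAgreement [Fintype S] [DecidableEq S] [Fintype R] [Nonempty R]
    (q : ℕ) (α γ : ℝ) : Prop where
  accuracy : ∀ f : S → R, 1 - α ≤ prob P.coins {r | P.outA f r = P.outB f r}
  secrecy : ∀ E : List Bool → OracleAlgorithm S R, (∀ τ f, (E τ).numQueries f ≤ q) →
    prob (indep (PMF.uniformOfFintype (S → R)) P.coins)
      {v | (E (P.trans v.1 v.2)).eval v.1 = P.outA v.1 v.2} ≤ γ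

end NonAdaptiveProtocol

end KeyAgreement

set_option linter.unusedSectionVars false

/-! Run `A` on an oracle f and `B` on an independent oracle g. The data of the parties are then
independent, hence so are their outputs given the transcript, and guessing the likelier output of
`A` succeeds at least as often as the outputs agree. So 1-α-γ is at most the L¹ distance between the
leaf distributions (transcript and outputs) for a common oracle and for independent ones
(`one_sub_sub_le_sum_abs_hybrid`).

This distance is small when transcripts are short. Let N = |D| ≥ 2ℓ, let p = ℓ/N, and let H bound
the logarithm of the number of leaves. The oracles are made independent one point x at a time. By a
symmetry exchanging the two oracle values at x, the change matters only if both parties query x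
(`hybrid_sub_hybrid_erase`), which has probability p². Given this, the cut-and-paste property of the
Hellinger distance bounds the effect by how strongly the leaf depends on whether x is in a query set
(`sum_abs_avgMem_mul_sub_le`). An entropy bound, resting on Maclaurin's inequality, shows that these
squared distances sum over x to O(H/p) (`sum_hell_le`). Releasing the cheapest of n remaining points
costs O(p²√(H/(pn))); the total over n ≤ N is O(p²√(HN/p)), whose square is O(Hℓ³/N²).

Finally q < N, since an eavesdropper that queries all of D breaks the protocol
(`one_sub_le_of_card_le`). The result has (1-α-γ)², which is stronger than the fourth power. -/

namespace KeyAgreement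

open Finset

/-! ### Elementary symmetric polynomials and Maclaurin's inequality. -/

section Maclaurin

variable {S : Type*} [DecidableEq S]

theorem sum_mul_sum_filter_mem (D : Finset S) (k : ℕ) (g : S → ℝ) (u : Finset S → ℝ) :
    ∑ x ∈ D, g x * ∑ Q ∈ (D.powersetCard k).filter (x ∈ ·), u Q =
      ∑ Q ∈ D.powersetCard k, u Q * ∑ x ∈ Q, g x := by
  simp_rw [mul_sum, sum_filter]
  rw [sum_comm]
  refine sum_congr rfl fun Q hQ => ?_
  rw [← sum_filter]
  have : D.filter (· ∈ Q) = Q := by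
    ext x
    simp only [mem_filter, and_iff_right_iff_imp]
    exact fun hx => (mem_powersetCard.1 hQ).1 hx
  rw [this]
  exact sum_congr rfl fun x _ => mul_comm _ _

/-- The elementary symmetric polynomial of degree `k` in the values `z x`, `x ∈ D`. -/
def elemSymm (D : Finset S) (k : ℕ) (z : S → ℝ) : ℝ :=
  ∑ Q ∈ D.powersetCard k, ∏ x ∈ Q, z x

theorem elemSymm_nonneg (D : Finset S) (k : ℕ) {z : S → ℝ} (hz : ∀ x, 0 ≤ z x) :
    0 ≤ elemSymm D k z :=
  sum_nonneg fun _ _ => prod_nonneg fun _ _ => hz _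

theorem sum_filter_mem_prod {D : Finset S} (k : ℕ) (z : S → ℝ) {x : S} (hx : x ∈ D) :
    ∑ Q ∈ (D.powersetCard (k + 1)).filter (x ∈ ·), ∏ y ∈ Q, z y =
      z x * elemSymm (D.erase x) k z := by
  rw [elemSymm, mul_sum]
  symm
  refine sum_bij' (fun Q _ => insert x Q) (fun Q _ => Q.erase x) ?_ ?_ ?_ ?_ ?_
  · intro Q hQ
    rw [mem_powersetCard] at hQ
    have hxQ : x ∉ Q := fun h => by simpa using hQ.1 h
    simp only [mem_filter, mem_powersetCard, mem_insert, true_or, and_true]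
    refine ⟨insert_subset hx (hQ.1.trans (erase_subset _ _)), ?_⟩
    rw [card_insert_of_notMem hxQ, hQ.2]
  · intro Q hQ
    simp only [mem_filter, mem_powersetCard] at hQ ⊢
    exact ⟨erase_subset_erase _ hQ.1.1, by rw [card_erase_of_mem hQ.2, hQ.1.2]; rfl⟩
  · intro Q hQ
    rw [mem_powersetCard] at hQ
    exact erase_insert fun h => by simpa using hQ.1 h
  · intro Q hQ
    exact insert_erase (mem_filter.1 hQ).2
  · intro Q hQ
    rw [mem_powersetCard] at hQ
    rw [prod_insert fun h => by simpa using hQ.1 h]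

theorem elemSymm_succ_eq {D : Finset S} (k : ℕ) (z : S → ℝ) {x : S} (hx : x ∈ D) :
    elemSymm D (k + 1) z =
      elemSymm (D.erase x) (k + 1) z + z x * elemSymm (D.erase x) k z := by
  rw [← sum_filter_mem_prod k z hx, elemSymm, elemSymm,
    ← sum_filter_add_sum_filter_not (D.powersetCard (k + 1)) (x ∈ ·), add_comm]
  congr 2
  ext Q
  simp only [mem_filter, mem_powersetCard, subset_erase]
  tauto

theorem sum_mul_elemSymm_erase (D : Finset S) (k : ℕ) (z : S → ℝ) :
    ∑ x ∈ D, z x * elemSymm (D.erase x) k z = (k + 1) * elemSymm D (k + 1) z := by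
  have h := sum_mul_sum_filter_mem D (k + 1) (fun _ => 1) (fun Q => ∏ y ∈ Q, z y)
  simp only [one_mul] at h
  rw [← sum_congr rfl fun x hx => sum_filter_mem_prod k z hx, h, elemSymm, mul_sum]
  refine sum_congr rfl fun Q hQ => ?_
  simp [(mem_powersetCard.1 hQ).2, mul_comm]

/-- Splitting off the other variable on each side leaves the common term with factor `z x * z y`,
which cancels. This is the monotonicity needed for Chebyshev's sum inequality. -/
theorem mul_elemSymm_erase_mono {D : Finset S} (k : ℕ) {z : S → ℝ} (hz : ∀ x, 0 ≤ z x)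
    {x y : S} (hx : x ∈ D) (hy : y ∈ D) (hxy : z x ≤ z y) :
    z x * elemSymm (D.erase x) k z ≤ z y * elemSymm (D.erase y) k z := by
  rcases eq_or_ne x y with rfl | hne
  · exact le_rfl
  cases k with
  | zero => simpa [elemSymm] using hxy
  | succ k =>
    rw [elemSymm_succ_eq (D := D.erase x) k z (mem_erase.2 ⟨hne.symm, hy⟩),
      elemSymm_succ_eq (D := D.erase y) k z (mem_erase.2 ⟨hne, hx⟩), erase_right_comm]
    have := mul_le_mul_of_nonneg_right hxy (elemSymm_nonneg ((D.erase y).erase x) (k + 1) hz)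
    linarith

/-- In the product of `∑ z` with a symmetric polynomial, a factor `z x` either extends a set
avoiding x or squares a variable already present. Chebyshev's sum inequality bounds the square terms
from below. -/
theorem elemSymm_succ_le (D : Finset S) (k : ℕ) {z : S → ℝ} (hz : ∀ x, 0 ≤ z x) :
    (D.card : ℝ) * ((k + 1) * elemSymm D (k + 1) z) ≤
      (D.card - k) * ((∑ x ∈ D, z x) * elemSymm D k z) := by
  cases k with
  | zero =>
    rw [← sum_mul_elemSymm_erase]
    simp [elemSymm]
  | succ k =>
    have h1 : (∑ x ∈ D, z x) * elemSymm D (k + 1) z =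
        ((k + 1 : ℕ) + 1) * elemSymm D (k + 1 + 1) z +
          ∑ x ∈ D, z x * (z x * elemSymm (D.erase x) k z) := by
      rw [← sum_mul_elemSymm_erase, ← sum_add_distrib, sum_mul]
      refine sum_congr rfl fun x hx => ?_
      rw [elemSymm_succ_eq k z hx]
      ring
    have h2 : (∑ x ∈ D, z x) * ∑ x ∈ D, z x * elemSymm (D.erase x) k z ≤
        D.card * ∑ x ∈ D, z x * (z x * elemSymm (D.erase x) k z) := by
      refine MonovaryOn.sum_mul_sum_le_card_mul_sum ?_
      intro x hx y hy hxy
      by_contra! h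
      exact absurd (mul_elemSymm_erase_mono k hz hy hx h.le) (not_le.2 hxy)
    rw [sum_mul_elemSymm_erase] at h2
    push_cast at h1 h2 ⊢
    nlinarith

/-- Maclaurin's inequality between the first and the `k`-th elementary symmetric mean. -/
theorem elemSymm_mul_card_pow_le (D : Finset S) (k : ℕ) {z : S → ℝ} (hz : ∀ x, 0 ≤ z x) :
    elemSymm D k z * (D.card : ℝ) ^ k ≤ D.card.choose k * (∑ x ∈ D, z x) ^ k := by
  induction k with
  | zero => simp [elemSymm]
  | succ k ih =>
    rcases le_or_gt D.card k with hk | hk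
    · have : D.powersetCard (k + 1) = ∅ := powersetCard_eq_empty.2 (by omega)
      rw [elemSymm, this, sum_empty, zero_mul]
      exact mul_nonneg (Nat.cast_nonneg _) (pow_nonneg (sum_nonneg fun x _ => hz x) _)
    have h0 : (0 : ℝ) ≤ ∑ x ∈ D, z x := sum_nonneg fun x _ => hz x
    have hk' : (0 : ℝ) ≤ D.card - k := by
      have : (k : ℝ) ≤ D.card := by exact_mod_cast hk.le
      linarith
    have h1 := mul_le_mul_of_nonneg_right (elemSymm_succ_le D k hz)
      (pow_nonneg (Nat.cast_nonneg D.card : (0 : ℝ) ≤ D.card) k)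
    have h2 := mul_le_mul_of_nonneg_left ih (mul_nonneg hk' h0)
    have h3 : ((D.card : ℝ) - k) * D.card.choose k = (k + 1) * D.card.choose (k + 1) := by
      have := Nat.choose_succ_right_eq D.card k
      have h : ((D.card.choose (k + 1) * (k + 1) : ℕ) : ℝ) = (D.card.choose k * (D.card - k) : ℕ) := by
        rw [this]
      rw [Nat.cast_mul, Nat.cast_mul, Nat.cast_sub hk.le] at h
      push_cast at h
      linarith
    have h4 : (0 : ℝ) < k + 1 := by positivity
    refine le_of_mul_le_mul_left ?_ h4
    calc ((k : ℝ) + 1) * (elemSymm D (k + 1) z * (D.card : ℝ) ^ (k + 1))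
        = D.card * ((k + 1) * elemSymm D (k + 1) z) * (D.card : ℝ) ^ k := by ring
      _ ≤ (D.card - k) * ((∑ x ∈ D, z x) * elemSymm D k z) * (D.card : ℝ) ^ k := h1
      _ = (D.card - k) * (∑ x ∈ D, z x) * (elemSymm D k z * (D.card : ℝ) ^ k) := by ring
      _ ≤ (D.card - k) * (∑ x ∈ D, z x) * (D.card.choose k * (∑ x ∈ D, z x) ^ k) := h2
      _ = ((D.card - k) * D.card.choose k) * (∑ x ∈ D, z x) ^ (k + 1) := by ring
      _ = _ := by rw [h3]; ring

end Maclaurin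

end KeyAgreement

namespace KeyAgreement

open Finset

/-! ### Marginals of a weighted uniformly random subset. -/

section Average

variable {S : Type*} [DecidableEq S]

/-- The expectation of `u` at a uniformly random `k`-element subset of `D`. -/
noncomputable def avg (D : Finset S) (k : ℕ) (u : Finset S → ℝ) : ℝ :=
  (∑ Q ∈ D.powersetCard k, u Q) / D.card.choose k

/-- The part of `avg D k u` that comes from the sets containing `x`. -/
noncomputable def avgMem (D : Finset S) (k : ℕ) (u : Finset S → ℝ) (x : S) : ℝ :=
  (∑ Q ∈ (D.powersetCard k).filter (x ∈ ·), u Q) / D.card.choose k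

/-- The part of `avg D k u` that comes from the sets not containing `x`. -/
noncomputable def avgNotMem (D : Finset S) (k : ℕ) (u : Finset S → ℝ) (x : S) : ℝ :=
  (∑ Q ∈ (D.powersetCard k).filter (x ∉ ·), u Q) / D.card.choose k

theorem avgMem_add_avgNotMem (D : Finset S) (k : ℕ) (u : Finset S → ℝ) (x : S) :
    avgMem D k u x + avgNotMem D k u x = avg D k u := by
  rw [avgMem, avgNotMem, avg, ← add_div, sum_filter_add_sum_filter_not]

variable {D : Finset S} {k : ℕ} {u : Finset S → ℝ}

theorem avg_nonneg (hu : ∀ Q ∈ D.powersetCard k, 0 ≤ u Q) : 0 ≤ avg D k u :=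
  div_nonneg (sum_nonneg hu) (Nat.cast_nonneg _)

theorem avgMem_nonneg (hu : ∀ Q ∈ D.powersetCard k, 0 ≤ u Q) (x : S) : 0 ≤ avgMem D k u x :=
  div_nonneg (sum_nonneg fun Q hQ => hu Q (mem_filter.1 hQ).1) (Nat.cast_nonneg _)

theorem avgNotMem_nonneg (hu : ∀ Q ∈ D.powersetCard k, 0 ≤ u Q) (x : S) :
    0 ≤ avgNotMem D k u x :=
  div_nonneg (sum_nonneg fun Q hQ => hu Q (mem_filter.1 hQ).1) (Nat.cast_nonneg _)

theorem sum_avgMem_mul (D : Finset S) (k : ℕ) (u : Finset S → ℝ) (g : S → ℝ) :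
    ∑ x ∈ D, g x * avgMem D k u x = avg D k fun Q => u Q * ∑ x ∈ Q, g x := by
  simp_rw [avgMem, avg, ← sum_mul_sum_filter_mem, mul_div_assoc', sum_div]

theorem sum_avgMem (D : Finset S) (k : ℕ) (u : Finset S → ℝ) :
    ∑ x ∈ D, avgMem D k u x = k * avg D k u := by
  have h := sum_avgMem_mul D k u fun _ => 1
  simp only [one_mul] at h
  rw [h, avg, avg, mul_div_assoc', mul_sum]
  congr 1
  refine sum_congr rfl fun Q hQ => ?_
  simp [(mem_powersetCard.1 hQ).2, mul_comm]

/-- The marginals of a uniformly random `k`-element set, weighted by a density `u ≤ 1`: their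
relative entropy is at most that of the density. -/
theorem sum_avgMem_mul_log_le (hk : 0 < k) (hkD : k ≤ D.card)
    (hu : ∀ Q ∈ D.powersetCard k, 0 ≤ u Q) (hu1 : ∀ Q ∈ D.powersetCard k, u Q ≤ 1)
    (ha : 0 < avg D k u) :
    ∑ x ∈ D, avgMem D k u x * Real.log (avgMem D k u x / (k / D.card * avg D k u)) ≤
      -(avg D k u * Real.log (avg D k u)) := by
  set a := avg D k u with hadef
  set z : S → ℝ := fun x => avgMem D k u x / (k / D.card * a) with hz
  have hN : (0 : ℝ) < D.card := by exact_mod_cast hk.trans_le hkD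
  have hk' : (0 : ℝ) < k := by exact_mod_cast hk
  have hM : (0 : ℝ) < D.card.choose k := by exact_mod_cast Nat.choose_pos hkD
  have hz0 : ∀ x, 0 ≤ z x := fun x =>
    div_nonneg (avgMem_nonneg hu x) (by positivity)
  have hsum : ∑ x ∈ D, z x = D.card := by
    rw [hz, ← sum_div, sum_avgMem, ← hadef]
    field_simp
  -- The numbers `z x` have mean 1 over D, so by Maclaurin the products over k-sets have mean at
  -- most 1: they serve as a reference density.
  have hmac : elemSymm D k z ≤ D.card.choose k := by
    have h := elemSymm_mul_card_pow_le D k hz0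
    rw [hsum] at h
    exact le_of_mul_le_mul_right h (by positivity)
  have hsum' : ∑ x ∈ D, avgMem D k u x * Real.log (z x) =
      avg D k fun Q => u Q * ∑ x ∈ Q, Real.log (z x) := by
    rw [← sum_avgMem_mul]
    exact sum_congr rfl fun x _ => mul_comm _ _
  rw [hsum']
  -- Gibbs' inequality pointwise: `log y ≤ y - 1` at `y = a * ∏ z`, times `u Q`; then `u Q ≤ 1`
  -- drops the weight of the product. The right sides sum to at most 0 by `hmac`.
  have hpt : ∀ Q ∈ D.powersetCard k,
      u Q * (Real.log a + ∑ x ∈ Q, Real.log (z x)) ≤ a * ∏ x ∈ Q, z x - u Q := by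
    intro Q hQ
    have hP : 0 ≤ ∏ x ∈ Q, z x := prod_nonneg fun x _ => hz0 x
    rcases (hu Q hQ).eq_or_lt with h0 | h0
    · rw [← h0, zero_mul, sub_zero]
      positivity
    have hzpos : ∀ x ∈ Q, 0 < z x := by
      intro x hx
      refine div_pos (div_pos ?_ hM) (by positivity)
      refine h0.trans_le (single_le_sum (f := u) (fun Q' hQ' => hu Q' (mem_filter.1 hQ').1) ?_)
      exact mem_filter.2 ⟨hQ, hx⟩
    have hPpos : 0 < ∏ x ∈ Q, z x := prod_pos hzpos
    rw [← Real.log_prod fun x hx => (hzpos x hx).ne', ← Real.log_mul ha.ne' hPpos.ne']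
    have h1 := Real.log_le_sub_one_of_pos (mul_pos ha hPpos)
    have h2 := mul_le_mul_of_nonneg_left h1 h0.le
    have h3 := mul_le_mul_of_nonneg_right (hu1 Q hQ) (mul_pos ha hPpos).le
    linarith
  have htot := sum_le_sum hpt
  rw [sum_sub_distrib, ← mul_sum] at htot
  simp_rw [mul_add] at htot
  rw [sum_add_distrib, ← sum_mul] at htot
  have hS : ∑ Q ∈ D.powersetCard k, u Q = a * D.card.choose k := by
    rw [hadef, avg, div_mul_cancel₀ _ hM.ne']
  rw [hS] at htot
  rw [avg, div_le_iff₀ hM]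
  have := mul_le_mul_of_nonneg_left hmac ha.le
  rw [elemSymm] at this
  linarith

/-- Relative entropy dominates the squared Hellinger distance, by `log t ≤ t - 1` at `t = √c / √x`.
The linear correction makes this true term by term. -/
theorem sq_sqrt_sub_sqrt_le {x c : ℝ} (hx : 0 ≤ x) (hc : 0 < c) :
    (√x - √c) ^ 2 ≤ x * Real.log (x / c) - (x - c) := by
  rcases hx.eq_or_lt with rfl | hx
  · simp [hc.le]
  have hs := Real.sqrt_pos.2 hx
  have ht := Real.sqrt_pos.2 hc
  have hs2 := Real.sq_sqrt hx.le
  have ht2 := Real.sq_sqrt hc.le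
  have h1 := Real.log_le_sub_one_of_pos (div_pos ht hs)
  have h2 : Real.log (x / c) = -2 * Real.log (√c / √x) := by
    rw [Real.log_div hx.ne' hc.ne', Real.log_div ht.ne' hs.ne', Real.log_sqrt hc.le,
      Real.log_sqrt hx.le]
    ring
  have h3 : x * (√c / √x) = √x * √c := by
    field_simp
    rw [hs2]
  have h4 := mul_le_mul_of_nonneg_left h1 hx.le
  rw [mul_sub, h3, mul_one] at h4
  rw [h2]
  linarith [sub_sq (√x) (√c)]

theorem sum_sq_sqrt_avgMem_sub_le (hk : 0 < k) (hkD : k ≤ D.card)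
    (hu : ∀ Q ∈ D.powersetCard k, 0 ≤ u Q) (hu1 : ∀ Q ∈ D.powersetCard k, u Q ≤ 1) :
    ∑ x ∈ D, (√(avgMem D k u x) - √(k / D.card * avg D k u)) ^ 2 ≤
      -(avg D k u * Real.log (avg D k u)) := by
  have hN : (0 : ℝ) < D.card := by exact_mod_cast hk.trans_le hkD
  have hk' : (0 : ℝ) < k := by exact_mod_cast hk
  have ha0 := avg_nonneg hu
  have hxnn := avgMem_nonneg hu
  rcases ha0.eq_or_lt with ha | ha
  · have hx : ∀ x, avgMem D k u x = 0 := fun x => by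
      have := avgMem_add_avgNotMem D k u x
      have := avgNotMem_nonneg hu x
      have := hxnn x
      linarith
    simp [← ha, hx]
  refine le_trans ?_ (sum_avgMem_mul_log_le hk hkD hu hu1 ha)
  -- Both families sum to `k * avg D k u`, so the linear corrections disappear.
  have h0 : ∑ x ∈ D, (avgMem D k u x - k / D.card * avg D k u) = 0 := by
    rw [sum_sub_distrib, sum_avgMem, sum_const, nsmul_eq_mul]
    field_simp
    ring
  rw [← sub_zero (∑ x ∈ D, avgMem D k u x * _), ← h0, ← sum_sub_distrib]
  exact sum_le_sum fun x _ => sq_sqrt_sub_sqrt_le (hxnn x) (by positivity)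

/-- Passes from a comparison with the overall mean to one between the two conditional means X² and
Y². The identity `b - p * a = p * (1 - p) * (X² - Y²)` is factored on both sides as a difference of
squares; 12 is 6 / (1 - p) at p = 1/2. -/
theorem mul_sq_sqrt_sub_le {a b p : ℝ} (hb : 0 ≤ b) (hba : b ≤ a) (hp : 0 < p) (hp2 : p ≤ 1 / 2) :
    p * (√(b / p) - √((a - b) / (1 - p))) ^ 2 ≤ 12 * (√b - √(p * a)) ^ 2 := by
  have hq : 0 < 1 - p := by linarith
  have ha : 0 ≤ a := hb.trans hba
  set X := √(b / p)
  set Y := √((a - b) / (1 - p))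
  have hX : X ^ 2 = b / p := Real.sq_sqrt (by positivity)
  have hY : Y ^ 2 = (a - b) / (1 - p) := Real.sq_sqrt (div_nonneg (by linarith) hq.le)
  have hX0 : 0 ≤ X := Real.sqrt_nonneg _
  have hY0 : 0 ≤ Y := Real.sqrt_nonneg _
  set s := √b
  set t := √(p * a)
  have hs : s ^ 2 = b := Real.sq_sqrt hb
  have ht : t ^ 2 = p * a := Real.sq_sqrt (by positivity)
  have hb' : b = p * X ^ 2 := by rw [hX]; field_simp
  have ha' : a - b = (1 - p) * Y ^ 2 := by rw [hY]; field_simp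
  rcases (add_nonneg hX0 hY0).eq_or_lt with h | h
  · have h1 : X = 0 := by linarith
    have h2 : Y = 0 := by linarith
    rw [h1, h2]
    simp
    positivity
  refine le_of_mul_le_mul_right ?_ (pow_pos h 2)
  have e1 : s ^ 2 - t ^ 2 = p * (1 - p) * (X ^ 2 - Y ^ 2) := by
    rw [hs, ht]
    linear_combination (1 - p) * hb' - p * ha'
  have e2 : s ^ 2 + t ^ 2 ≤ 3 * (p * (1 - p)) * (X ^ 2 + Y ^ 2) := by
    have : p * (1 - p) * (X ^ 2 + Y ^ 2) = b + p * a - 2 * (p * b) := by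
      linear_combination -(1 - p) * hb' - p * ha'
    rw [hs, ht, mul_assoc, this]
    nlinarith
  have e3 : (p * (1 - p)) ^ 2 * ((X - Y) * (X + Y)) ^ 2 ≤
      2 * (s - t) ^ 2 * (3 * (p * (1 - p)) * (X + Y) ^ 2) := by
    calc (p * (1 - p)) ^ 2 * ((X - Y) * (X + Y)) ^ 2 = (s ^ 2 - t ^ 2) ^ 2 := by rw [e1]; ring
      _ = (s - t) ^ 2 * (s + t) ^ 2 := by ring
      _ ≤ (s - t) ^ 2 * (2 * (s ^ 2 + t ^ 2)) := by
        gcongr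
        nlinarith [sq_nonneg (s - t)]
      _ ≤ (s - t) ^ 2 * (2 * (3 * (p * (1 - p)) * (X + Y) ^ 2)) := by
        gcongr
        refine e2.trans ?_
        gcongr
        nlinarith [mul_nonneg hX0 hY0]
      _ = _ := by ring
  have e4 : (1 - p) * (p * (X - Y) ^ 2 * (X + Y) ^ 2) ≤ 6 * ((s - t) ^ 2 * (X + Y) ^ 2) := by
    refine le_of_mul_le_mul_left ?_ (mul_pos hp hq)
    nlinarith [e3]
  have e5 : 0 ≤ p * (X - Y) ^ 2 * (X + Y) ^ 2 := by positivity
  nlinarith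

end Average

end KeyAgreement

namespace KeyAgreement

open Finset

/-! ### Hellinger distance, cut-and-paste and entropy. -/

section Hellinger

variable {Λ : Type*} (L : Finset Λ)

/-- AM-GM with a free parameter `κ` replaces Cauchy–Schwarz, so that the bound stays linear in the
squared Hellinger distance and can be summed over oracles. -/
theorem sum_abs_sub_le {P Q : Λ → ℝ} (hP : ∀ τ, 0 ≤ P τ) (hQ : ∀ τ, 0 ≤ Q τ)
    (hP1 : ∑ τ ∈ L, P τ = 1) (hQ1 : ∑ τ ∈ L, Q τ = 1) {κ : ℝ} (hκ : 0 < κ) :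
    ∑ τ ∈ L, |P τ - Q τ| ≤ κ + (∑ τ ∈ L, (√(P τ) - √(Q τ)) ^ 2) / κ := by
  have hpt : ∀ τ ∈ L, |P τ - Q τ| ≤ (√(P τ) - √(Q τ)) ^ 2 / κ + κ / 2 * (P τ + Q τ) := by
    intro τ _
    have h1 := Real.sq_sqrt (hP τ)
    have h2 := Real.sq_sqrt (hQ τ)
    set p := √(P τ)
    set q := √(Q τ)
    have h3 : |P τ - Q τ| = |p - q| * |p + q| := by
      rw [← abs_mul, ← h1, ← h2]
      ring_nf
    have h4 : |p - q| * |p + q| ≤ |p - q| ^ 2 / κ + κ * |p + q| ^ 2 / 4 := by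
      rw [← sub_nonneg]
      have : |p - q| ^ 2 / κ + κ * |p + q| ^ 2 / 4 - |p - q| * |p + q| =
          (|p - q| - κ / 2 * |p + q|) ^ 2 / κ := by
        field_simp
        ring
      rw [this]
      positivity
    rw [sq_abs, sq_abs] at h4
    rw [h3]
    nlinarith [mul_nonneg hκ.le (sq_nonneg (p - q))]
  calc ∑ τ ∈ L, |P τ - Q τ|
      ≤ ∑ τ ∈ L, ((√(P τ) - √(Q τ)) ^ 2 / κ + κ / 2 * (P τ + Q τ)) := sum_le_sum hpt
    _ = _ := by
      rw [sum_add_distrib, ← mul_sum, sum_add_distrib, hP1, hQ1, sum_div]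
      ring

variable {A₀ A₁ B₀ B₁ B₂ : Λ → ℝ}

/-- The cut-and-paste property of the Hellinger distance between rectangular distributions. -/
theorem sum_sq_sqrt_mul_sub_eq (hA₀ : ∀ τ, 0 ≤ A₀ τ) (hA₁ : ∀ τ, 0 ≤ A₁ τ)
    (hB₀ : ∀ τ, 0 ≤ B₀ τ) (hB₁ : ∀ τ, 0 ≤ B₁ τ)
    (h00 : ∑ τ ∈ L, A₀ τ * B₀ τ = 1) (h01 : ∑ τ ∈ L, A₀ τ * B₁ τ = 1)
    (h10 : ∑ τ ∈ L, A₁ τ * B₀ τ = 1) (h11 : ∑ τ ∈ L, A₁ τ * B₁ τ = 1) :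
    ∑ τ ∈ L, (√(A₁ τ * B₁ τ) - √(A₀ τ * B₀ τ)) ^ 2 =
      ∑ τ ∈ L, (√(A₁ τ * B₀ τ) - √(A₀ τ * B₁ τ)) ^ 2 := by
  rw [← sub_eq_zero, ← sum_sub_distrib]
  -- Both cross terms are the product of all four roots, so they cancel; the four remaining terms
  -- each sum to 1.
  have hpt : ∀ τ ∈ L, (√(A₁ τ * B₁ τ) - √(A₀ τ * B₀ τ)) ^ 2 -
      (√(A₁ τ * B₀ τ) - √(A₀ τ * B₁ τ)) ^ 2 =
      A₁ τ * B₁ τ + A₀ τ * B₀ τ - A₁ τ * B₀ τ - A₀ τ * B₁ τ := by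
    intro τ _
    simp only [Real.sqrt_mul (hA₀ τ), Real.sqrt_mul (hA₁ τ)]
    have a0 := Real.sq_sqrt (hA₀ τ)
    have a1 := Real.sq_sqrt (hA₁ τ)
    have b0 := Real.sq_sqrt (hB₀ τ)
    have b1 := Real.sq_sqrt (hB₁ τ)
    conv_rhs => rw [← a0, ← a1, ← b0, ← b1]
    ring
  rw [sum_congr rfl hpt]
  simp only [sum_sub_distrib, sum_add_distrib, h00, h01, h10, h11]
  ring

/-- After cut-and-paste the path from `A₁ B₀` to `A₀ B₁` passes through `A₀ B₀`, changing one factor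
at a time. -/
theorem sum_sq_sqrt_mul_sub_le (hA₀ : ∀ τ, 0 ≤ A₀ τ) (hA₁ : ∀ τ, 0 ≤ A₁ τ)
    (hB₀ : ∀ τ, 0 ≤ B₀ τ) (hB₁ : ∀ τ, 0 ≤ B₁ τ)
    (h00 : ∑ τ ∈ L, A₀ τ * B₀ τ = 1) (h01 : ∑ τ ∈ L, A₀ τ * B₁ τ = 1)
    (h10 : ∑ τ ∈ L, A₁ τ * B₀ τ = 1) (h11 : ∑ τ ∈ L, A₁ τ * B₁ τ = 1) :
    ∑ τ ∈ L, (√(A₁ τ * B₁ τ) - √(A₀ τ * B₀ τ)) ^ 2 ≤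
      2 * ∑ τ ∈ L, B₀ τ * (√(A₁ τ) - √(A₀ τ)) ^ 2 +
        2 * ∑ τ ∈ L, A₀ τ * (√(B₁ τ) - √(B₀ τ)) ^ 2 := by
  rw [sum_sq_sqrt_mul_sub_eq L hA₀ hA₁ hB₀ hB₁ h00 h01 h10 h11, mul_sum, mul_sum,
    ← sum_add_distrib]
  refine sum_le_sum fun τ _ => ?_
  simp only [Real.sqrt_mul (hA₀ τ), Real.sqrt_mul (hA₁ τ)]
  have a0 := Real.sq_sqrt (hA₀ τ)
  have b0 := Real.sq_sqrt (hB₀ τ)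
  set a := √(A₀ τ)
  set b := √(B₀ τ)
  set a' := √(A₁ τ)
  set b' := √(B₁ τ)
  rw [← a0, ← b0]
  nlinarith [sq_nonneg (b * (a' - a) + a * (b' - b))]

/-- Both distributions are compared with `A₀ B₀`. In the application, index 0 means that x is not
queried, while `B₁` and `B₂` are `B` querying x under two oracle values. -/
theorem sum_abs_mul_sub_mul_le (hA₀ : ∀ τ, 0 ≤ A₀ τ) (hA₁ : ∀ τ, 0 ≤ A₁ τ)
    (hB₀ : ∀ τ, 0 ≤ B₀ τ) (hB₁ : ∀ τ, 0 ≤ B₁ τ) (hB₂ : ∀ τ, 0 ≤ B₂ τ)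
    (h00 : ∑ τ ∈ L, A₀ τ * B₀ τ = 1) (h01 : ∑ τ ∈ L, A₀ τ * B₁ τ = 1)
    (h02 : ∑ τ ∈ L, A₀ τ * B₂ τ = 1) (h10 : ∑ τ ∈ L, A₁ τ * B₀ τ = 1)
    (h11 : ∑ τ ∈ L, A₁ τ * B₁ τ = 1) (h12 : ∑ τ ∈ L, A₁ τ * B₂ τ = 1)
    {κ : ℝ} (hκ : 0 < κ) :
    ∑ τ ∈ L, |A₁ τ * B₁ τ - A₁ τ * B₂ τ| ≤
      κ + (8 * ∑ τ ∈ L, B₀ τ * (√(A₁ τ) - √(A₀ τ)) ^ 2 +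
        4 * ∑ τ ∈ L, A₀ τ * (√(B₁ τ) - √(B₀ τ)) ^ 2 +
        4 * ∑ τ ∈ L, A₀ τ * (√(B₂ τ) - √(B₀ τ)) ^ 2) / κ := by
  refine (sum_abs_sub_le L (fun τ => mul_nonneg (hA₁ τ) (hB₁ τ))
    (fun τ => mul_nonneg (hA₁ τ) (hB₂ τ)) h11 h12 hκ).trans ?_
  have h1 := sum_sq_sqrt_mul_sub_le L hA₀ hA₁ hB₀ hB₁ h00 h01 h10 h11
  have h2 := sum_sq_sqrt_mul_sub_le L hA₀ hA₁ hB₀ hB₂ h00 h02 h10 h12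
  have h3 : ∑ τ ∈ L, (√(A₁ τ * B₁ τ) - √(A₁ τ * B₂ τ)) ^ 2 ≤
      2 * ∑ τ ∈ L, (√(A₁ τ * B₁ τ) - √(A₀ τ * B₀ τ)) ^ 2 +
        2 * ∑ τ ∈ L, (√(A₁ τ * B₂ τ) - √(A₀ τ * B₀ τ)) ^ 2 := by
    rw [mul_sum, mul_sum, ← sum_add_distrib]
    refine sum_le_sum fun τ _ => ?_
    nlinarith [sq_nonneg (√(A₁ τ * B₁ τ) - √(A₀ τ * B₀ τ) +
      (√(A₁ τ * B₂ τ) - √(A₀ τ * B₀ τ)))]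
  gcongr
  linarith

/-- The entropy bound: if `P ≤ b` is a distribution on a set of `L.card` elements, then the
expectation of `-log b` is at most `log L.card`. -/
theorem sum_mul_neg_log_le {a b : Λ → ℝ} (ha : ∀ τ, 0 ≤ a τ) (hb : ∀ τ, 0 ≤ b τ)
    (hb1 : ∀ τ, b τ ≤ 1) (h1 : ∑ τ ∈ L, a τ * b τ = 1) :
    ∑ τ ∈ L, b τ * -(a τ * Real.log (a τ)) ≤ Real.log L.card := by
  have hne : L.Nonempty := by
    by_contra h
    rw [not_nonempty_iff_eq_empty.1 h] at h1
    simp at h1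
  have hM : (0 : ℝ) < L.card := by exact_mod_cast hne.card_pos
  -- Gibbs' inequality against the uniform distribution on L; `b ≤ 1` turns `b τ / L.card` into `1 /
  -- L.card`.
  have hpt : ∀ τ ∈ L, b τ * -(a τ * Real.log (a τ)) ≤
      a τ * b τ * Real.log L.card + (1 / L.card - a τ * b τ) := by
    intro τ _
    rcases (ha τ).eq_or_lt with h | h
    · simp [← h]
    have h2 := Real.log_le_sub_one_of_pos (show 0 < 1 / (a τ * L.card) by positivity)
    rw [Real.log_div one_ne_zero (by positivity), Real.log_one, Real.log_mul h.ne' hM.ne'] at h2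
    have h3 := mul_le_mul_of_nonneg_left h2 (mul_nonneg h.le (hb τ))
    have h4 : a τ * b τ * (1 / (a τ * L.card) - 1) = b τ / L.card - a τ * b τ := by
      field_simp
    have h5 : b τ / L.card ≤ 1 / L.card := by gcongr; exact hb1 τ
    rw [h4] at h3
    linarith
  refine (sum_le_sum hpt).trans (le_of_eq ?_)
  rw [sum_add_distrib, ← sum_mul, h1, sum_sub_distrib, h1, sum_const, nsmul_eq_mul]
  field_simp
  ring

end Hellinger

end KeyAgreement

namespace KeyAgreement

open Finset

/-! ### The influence of one element of the query domain. -/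

section Step

variable {S Λ : Type*} [DecidableEq S]

theorem avgMem_one {D : Finset S} {k : ℕ} (hk : 0 < k) (hkD : k ≤ D.card) {x : S} (hx : x ∈ D) :
    avgMem D k (fun _ => 1) x = k / D.card := by
  obtain ⟨k, rfl⟩ := Nat.exists_eq_succ_of_ne_zero hk.ne'
  have h := sum_filter_mem_prod k (fun _ => (1 : ℝ)) hx
  simp only [prod_const_one, one_mul, elemSymm] at h
  have hN : 0 < D.card := by omega
  have hM : (0 : ℝ) < D.card.choose (k + 1) := by exact_mod_cast Nat.choose_pos hkD
  rw [avgMem, Nat.succ_eq_add_one, h, sum_const, card_powersetCard, card_erase_of_mem hx, nsmul_eq_mul,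
    mul_one, div_eq_div_iff hM.ne' (by positivity)]
  have := Nat.add_one_mul_choose_eq (D.card - 1) k
  rw [Nat.sub_add_cancel hN] at this
  have h' : ((D.card * (D.card - 1).choose k : ℕ) : ℝ) = (D.card.choose (k + 1) * (k + 1) : ℕ) := by
    rw [this]
  push_cast at h' ⊢
  linarith

theorem avgNotMem_one {D : Finset S} {k : ℕ} (hk : 0 < k) (hkD : k ≤ D.card) {x : S}
    (hx : x ∈ D) : avgNotMem D k (fun _ => 1) x = 1 - k / D.card := by
  have h := avgMem_add_avgNotMem D k (fun _ => 1) x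
  have hM : (0 : ℝ) < D.card.choose k := by exact_mod_cast Nat.choose_pos hkD
  have h1 : avg D k (fun _ => 1) = 1 := by
    rw [avg, sum_const, card_powersetCard, nsmul_eq_mul, mul_one, div_self hM.ne']
  rw [avgMem_one hk hkD hx, h1] at h
  linarith

variable {D : Finset S} {k : ℕ} {L : Finset Λ}

theorem sum_sum_div_mul_sum_div {u v : Finset S → Λ → ℝ} {s t : Finset (Finset S)} (M : ℝ)
    (huv : ∀ Q ∈ s, ∀ Q' ∈ t, ∑ τ ∈ L, u Q τ * v Q' τ = 1) :
    ∑ τ ∈ L, (∑ Q ∈ s, u Q τ) / M * ((∑ Q ∈ t, v Q τ) / M) =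
      (∑ _Q ∈ s, 1) / M * ((∑ _Q ∈ t, 1) / M) := by
  have h : ∑ τ ∈ L, (∑ Q ∈ s, u Q τ) * ∑ Q ∈ t, v Q τ = (∑ Q ∈ s, 1) * ∑ Q ∈ t, 1 := by
    simp_rw [sum_mul_sum]
    rw [sum_comm]
    refine sum_congr rfl fun Q hQ => ?_
    rw [sum_comm]
    exact sum_congr rfl fun Q' hQ' => by rw [huv Q hQ Q' hQ', one_mul]
  calc _ = ∑ τ ∈ L, ((∑ Q ∈ s, u Q τ) * ∑ Q ∈ t, v Q τ) / (M * M) :=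
        sum_congr rfl fun τ _ => by rw [div_mul_div_comm]
    _ = _ := by rw [← sum_div, h, div_mul_div_comm]

/-- The Hellinger-type distance between the conditional distributions of the transcript, given
that the query set of one party contains `x` and given that it does not, when the query set of the
other party does not contain `x`. -/
noncomputable def hell (D : Finset S) (k : ℕ) (L : Finset Λ) (u v : Finset S → Λ → ℝ) (x : S) : ℝ :=
  ∑ τ ∈ L, avgNotMem D k (v · τ) x / (1 - k / D.card) *
    (√(avgMem D k (u · τ) x / (k / D.card)) -
      √(avgNotMem D k (u · τ) x / (1 - k / D.card))) ^ 2

/-- The function `u`, which gives for every query set the weights of the transcripts, takes values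
in the unit interval. -/
def IsWeight (D : Finset S) (k : ℕ) (u : Finset S → Λ → ℝ) : Prop :=
  ∀ Q ∈ D.powersetCard k, ∀ τ, 0 ≤ u Q τ ∧ u Q τ ≤ 1

/-- The weights `u` and `v` of two parties combine to a distribution on the transcripts, for all
their query sets. -/
def IsNormalized (D : Finset S) (k : ℕ) (L : Finset Λ) (u v : Finset S → Λ → ℝ) : Prop :=
  ∀ Q ∈ D.powersetCard k, ∀ Q' ∈ D.powersetCard k, ∑ τ ∈ L, u Q τ * v Q' τ = 1

theorem IsNormalized.symm {u v : Finset S → Λ → ℝ} (h : IsNormalized D k L u v) :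
    IsNormalized D k L v u := fun Q hQ Q' hQ' => by
  rw [← h Q' hQ' Q hQ]
  exact sum_congr rfl fun _ _ => mul_comm _ _

variable {u v v' : Finset S → Λ → ℝ}

theorem IsNormalized.sum_avg_mul_avg (h : IsNormalized D k L u v) (hkD : k ≤ D.card) :
    ∑ τ ∈ L, avg D k (u · τ) * avg D k (v · τ) = 1 := by
  have hM : (0 : ℝ) < D.card.choose k := by exact_mod_cast Nat.choose_pos hkD
  simp only [avg]
  rw [sum_sum_div_mul_sum_div _ h, sum_const, card_powersetCard, nsmul_eq_mul, mul_one,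
    div_self hM.ne', one_mul]

theorem IsWeight.avg_le_one (hu : IsWeight D k u) (hkD : k ≤ D.card) (τ : Λ) :
    avg D k (u · τ) ≤ 1 := by
  have hM : (0 : ℝ) < D.card.choose k := by exact_mod_cast Nat.choose_pos hkD
  rw [avg, div_le_one hM, ← card_powersetCard k D]
  refine (sum_le_sum fun Q hQ => (hu Q hQ τ).2).trans ?_
  simp

/-- For each leaf the marginal bound controls the sum over x by an entropy term, and these terms add
up to at most `log L.card`. The constant is 12 from `mul_sq_sqrt_sub_le` times 2 from `h4`. -/
theorem sum_hell_le (hk : 0 < k) (hkD : 2 * k ≤ D.card) (hu : IsWeight D k u)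
    (hv : IsWeight D k v) (huv : IsNormalized D k L u v) :
    k / D.card * ∑ x ∈ D, hell D k L u v x ≤ 24 * Real.log L.card := by
  have hkD' : k ≤ D.card := by omega
  have hN : (0 : ℝ) < D.card := by exact_mod_cast hk.trans_le hkD'
  have hk' : (0 : ℝ) < k := by exact_mod_cast hk
  have hp : (0 : ℝ) < k / D.card := by positivity
  have hp2 : (k : ℝ) / D.card ≤ 1 / 2 := by
    rw [div_le_div_iff₀ hN two_pos]
    have : ((2 * k : ℕ) : ℝ) ≤ D.card := by exact_mod_cast hkD
    push_cast at this
    linarith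
  have hq : (0 : ℝ) < 1 - k / D.card := by linarith
  have hu0 := fun τ Q hQ => (hu Q hQ τ).1
  have hu1 := fun τ Q hQ => (hu Q hQ τ).2
  have hv0 := fun τ Q hQ => (hv Q hQ τ).1
  simp only [hell]
  rw [sum_comm, mul_sum]
  have hpt : ∀ τ ∈ L, k / D.card * ∑ x ∈ D, avgNotMem D k (v · τ) x / (1 - k / D.card) *
      (√(avgMem D k (u · τ) x / (k / D.card)) -
        √(avgNotMem D k (u · τ) x / (1 - k / D.card))) ^ 2 ≤
      24 * (avg D k (v · τ) * -(avg D k (u · τ) * Real.log (avg D k (u · τ)))) := by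
    intro τ _
    have h1 := sum_sq_sqrt_avgMem_sub_le hk hkD' (hu0 τ) (hu1 τ)
    refine le_trans ?_ (mul_le_mul_of_nonneg_left
      (mul_le_mul_of_nonneg_left h1 (avg_nonneg (hv0 τ))) (by norm_num : (0 : ℝ) ≤ 24))
    rw [mul_sum, mul_sum, mul_sum]
    refine sum_le_sum fun x _ => ?_
    have hum := avgMem_add_avgNotMem D k (u · τ) x
    have hvm := avgMem_add_avgNotMem D k (v · τ) x
    have h2 := mul_sq_sqrt_sub_le (avgMem_nonneg (hu0 τ) x)
      (by linarith [avgNotMem_nonneg (hu0 τ) x]) hp hp2 (a := avg D k (u · τ))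
    have h3 : avg D k (u · τ) - avgMem D k (u · τ) x = avgNotMem D k (u · τ) x := by linarith
    rw [h3] at h2
    -- Conditioning on an event of probability at least 1/2 at most doubles the mean.
    have h4 : avgNotMem D k (v · τ) x / (1 - k / D.card) ≤ 2 * avg D k (v · τ) := by
      rw [div_le_iff₀ hq]
      have := avgMem_nonneg (hv0 τ) x
      nlinarith [avg_nonneg (hv0 τ)]
    have h5 := mul_le_mul h4 h2 (by positivity) (by linarith [avg_nonneg (hv0 τ)])
    linarith
  refine (sum_le_sum hpt).trans ?_
  rw [← mul_sum]
  refine mul_le_mul_of_nonneg_left ?_ (by norm_num)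
  exact sum_mul_neg_log_le L (fun τ => avg_nonneg (hu0 τ)) (fun τ => avg_nonneg (hv0 τ))
    (fun τ => hv.avg_le_one hkD' τ) (huv.sum_avg_mul_avg hkD')

/-- The factor `(k / D.card) ^ 2` is the probability that both sets contain x. Here `v'` stands for
`v` with the oracle changed at x; `hvv'` gives both the same base point `B₀`. -/
theorem sum_abs_avgMem_mul_sub_le (hk : 0 < k) (hkD : k < D.card) (hu : IsWeight D k u)
    (hv : IsWeight D k v) (hv' : IsWeight D k v') (huv : IsNormalized D k L u v)
    (huv' : IsNormalized D k L u v') {x : S} (hx : x ∈ D)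
    (hvv' : ∀ τ, avgNotMem D k (v · τ) x = avgNotMem D k (v' · τ) x) {κ : ℝ} (hκ : 0 < κ) :
    ∑ τ ∈ L, |avgMem D k (u · τ) x * (avgMem D k (v · τ) x - avgMem D k (v' · τ) x)| ≤
      (k / D.card) ^ 2 * (κ + (8 * hell D k L u v x + 4 * hell D k L v u x +
        4 * hell D k L v' u x) / κ) := by
  have hN : (0 : ℝ) < D.card := by exact_mod_cast hk.trans hkD
  have hk' : (0 : ℝ) < k := by exact_mod_cast hk
  have hp : (0 : ℝ) < k / D.card := by positivity
  have hq : (0 : ℝ) < 1 - k / D.card := by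
    rw [sub_pos, div_lt_one hN]
    exact_mod_cast hkD
  have m1 := avgMem_one hk hkD.le hx
  have n1 := avgNotMem_one hk hkD.le hx
  set p : ℝ := k / D.card with hpdef
  have hMM : ∀ {v : Finset S → Λ → ℝ}, IsNormalized D k L u v →
      ∑ τ ∈ L, avgMem D k (u · τ) x / p * (avgMem D k (v · τ) x / p) = 1 := by
    intro v huv
    simp_rw [div_mul_div_comm, ← sum_div]
    simp only [avgMem] at m1 ⊢
    rw [sum_sum_div_mul_sum_div _ fun Q hQ Q' hQ' =>
      huv Q (mem_filter.1 hQ).1 Q' (mem_filter.1 hQ').1, m1]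
    field_simp
  have hNM : ∀ {v : Finset S → Λ → ℝ}, IsNormalized D k L u v →
      ∑ τ ∈ L, avgNotMem D k (u · τ) x / (1 - p) * (avgMem D k (v · τ) x / p) = 1 := by
    intro v huv
    simp_rw [div_mul_div_comm, ← sum_div]
    simp only [avgMem, avgNotMem] at m1 n1 ⊢
    rw [sum_sum_div_mul_sum_div _ fun Q hQ Q' hQ' =>
      huv Q (mem_filter.1 hQ).1 Q' (mem_filter.1 hQ').1, m1, n1]
    field_simp
  have hMN : ∑ τ ∈ L, avgMem D k (u · τ) x / p * (avgNotMem D k (v · τ) x / (1 - p)) = 1 := by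
    simp_rw [div_mul_div_comm, ← sum_div]
    simp only [avgMem, avgNotMem] at m1 n1 ⊢
    rw [sum_sum_div_mul_sum_div _ fun Q hQ Q' hQ' =>
      huv Q (mem_filter.1 hQ).1 Q' (mem_filter.1 hQ').1, m1, n1]
    field_simp
  have hNN : ∑ τ ∈ L, avgNotMem D k (u · τ) x / (1 - p) *
      (avgNotMem D k (v · τ) x / (1 - p)) = 1 := by
    simp_rw [div_mul_div_comm, ← sum_div]
    simp only [avgNotMem] at n1 ⊢
    rw [sum_sum_div_mul_sum_div _ fun Q hQ Q' hQ' =>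
      huv Q (mem_filter.1 hQ).1 Q' (mem_filter.1 hQ').1, n1]
    field_simp
  have hu0 := fun τ Q hQ => (hu Q hQ τ).1
  have hv0 := fun τ Q hQ => (hv Q hQ τ).1
  have hv0' := fun τ Q hQ => (hv' Q hQ τ).1
  have key := sum_abs_mul_sub_mul_le L
    (fun τ => div_nonneg (avgNotMem_nonneg (hu0 τ) x) hq.le)
    (fun τ => div_nonneg (avgMem_nonneg (hu0 τ) x) hp.le)
    (fun τ => div_nonneg (avgNotMem_nonneg (hv0 τ) x) hq.le)
    (fun τ => div_nonneg (avgMem_nonneg (hv0 τ) x) hp.le)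
    (fun τ => div_nonneg (avgMem_nonneg (hv0' τ) x) hp.le)
    hNN (hNM huv) (hNM huv') hMN (hMM huv) (hMM huv') hκ
  have e1 : ∑ τ ∈ L, |avgMem D k (u · τ) x * (avgMem D k (v · τ) x - avgMem D k (v' · τ) x)| =
      p ^ 2 * ∑ τ ∈ L, |avgMem D k (u · τ) x / p * (avgMem D k (v · τ) x / p) -
        avgMem D k (u · τ) x / p * (avgMem D k (v' · τ) x / p)| := by
    rw [mul_sum]
    refine sum_congr rfl fun τ _ => ?_
    rw [← abs_of_pos (pow_pos hp 2), ← abs_mul]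
    congr 1
    field_simp
  rw [e1]
  refine mul_le_mul_of_nonneg_left (key.trans (le_of_eq ?_)) (by positivity)
  simp only [hell, ← hpdef, hvv']

end Step

end KeyAgreement

namespace KeyAgreement

open Finset

/-! ### Hybrids between a common oracle and independent oracles. -/

section Hybrid

variable {S R Λ : Type*} [Fintype S] [DecidableEq S] [Fintype R]

/-- The weights `a f Q` of the transcripts, for the oracle `f` and the query set `Q`, depend only
on the values of `f` on `Q`. -/
def IsLocal (a : (S → R) → Finset S → Λ → ℝ) : Prop :=
  ∀ f g Q, (∀ x ∈ Q, f x = g x) → a f Q = a g Q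

/-- Exchange the values of two functions at `x`. -/
def swapAt (x : S) : Equiv.Perm ((S → R) × (S → R)) :=
  Function.Involutive.toPerm
    (fun F => (Function.update F.1 x (F.2 x), Function.update F.2 x (F.1 x)))
    fun F => by ext y <;> by_cases h : y = x <;> simp [h, Function.update]

theorem swapAt_apply (x : S) (F : (S → R) × (S → R)) :
    swapAt x F = (Function.update F.1 x (F.2 x), Function.update F.2 x (F.1 x)) :=
  rfl

/-- After the exchange, the oracle of the second party for `Z.erase x` is its oracle for Z; only the
first party's value at x has changed, which is invisible unless it queries x. -/
theorem erase_piecewise_swapAt {Z : Finset S} {x : S} (hx : x ∈ Z) (F : (S → R) × (S → R)) :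
    (Z.erase x).piecewise (swapAt x F).1 (swapAt x F).2 = Z.piecewise F.1 F.2 := by
  ext y
  by_cases h : y = x
  · subst h
    simp [swapAt_apply, hx]
  · by_cases hy : y ∈ Z <;> simp [swapAt_apply, h, hy, Finset.piecewise]

theorem IsLocal.avgNotMem_eq {a : (S → R) → Finset S → Λ → ℝ} (ha : IsLocal a) (D : Finset S)
    (k : ℕ) (x : S) {f g : S → R} (hfg : ∀ y, y ≠ x → f y = g y) (τ : Λ) :
    avgNotMem D k (a f · τ) x = avgNotMem D k (a g · τ) x := by
  rw [avgNotMem, avgNotMem]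
  congr 1
  refine sum_congr rfl fun Q hQ => ?_
  have : x ∉ Q := (mem_filter.1 hQ).2
  rw [ha f g Q fun y hy => hfg y fun h => this (h ▸ hy)]

variable (D : Finset S) (k : ℕ) (a b : (S → R) → Finset S → Λ → ℝ)

/-- The sum over all pairs of oracles of the weight of a transcript, when the first party uses the
first oracle, and the second party uses the first oracle on `Z` and the second oracle off `Z`. -/
noncomputable def hybrid (Z : Finset S) (τ : Λ) : ℝ :=
  ∑ F : (S → R) × (S → R), avg D k (a F.1 · τ) * avg D k (b (Z.piecewise F.1 F.2) · τ)

variable {D k a b}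

/-- If the second party avoids x, its two oracles look the same; if the first party avoids x, the
bijection `swapAt x` equates the two sums. Only the part where both query x survives. -/
theorem hybrid_sub_hybrid_erase (ha : IsLocal a) (hb : IsLocal b) {Z : Finset S} {x : S}
    (hx : x ∈ Z) (τ : Λ) :
    hybrid D k a b Z τ - hybrid D k a b (Z.erase x) τ =
      ∑ F : (S → R) × (S → R), avgMem D k (a F.1 · τ) x *
        (avgMem D k (b (Z.piecewise F.1 F.2) · τ) x -
          avgMem D k (b ((Z.erase x).piecewise F.1 F.2) · τ) x) := by
  have h1 : ∑ F : (S → R) × (S → R), avgNotMem D k (a F.1 · τ) x *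
      avgMem D k (b ((Z.erase x).piecewise F.1 F.2) · τ) x =
      ∑ F : (S → R) × (S → R), avgNotMem D k (a F.1 · τ) x *
        avgMem D k (b (Z.piecewise F.1 F.2) · τ) x := by
    rw [← Equiv.sum_comp (swapAt x)]
    refine sum_congr rfl fun F _ => ?_
    rw [erase_piecewise_swapAt hx]
    congr 1
    refine ha.avgNotMem_eq D k x (fun y hy => ?_) τ
    simp [swapAt_apply, hy]
  have h2 : ∀ F : (S → R) × (S → R),
      avg D k (a F.1 · τ) * avg D k (b (Z.piecewise F.1 F.2) · τ) -
        avg D k (a F.1 · τ) * avg D k (b ((Z.erase x).piecewise F.1 F.2) · τ) =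
      avgMem D k (a F.1 · τ) x * (avgMem D k (b (Z.piecewise F.1 F.2) · τ) x -
          avgMem D k (b ((Z.erase x).piecewise F.1 F.2) · τ) x) +
        (avgNotMem D k (a F.1 · τ) x * avgMem D k (b (Z.piecewise F.1 F.2) · τ) x -
          avgNotMem D k (a F.1 · τ) x *
            avgMem D k (b ((Z.erase x).piecewise F.1 F.2) · τ) x) := by
    intro F
    rw [← avgMem_add_avgNotMem D k (a F.1 · τ) x,
      ← avgMem_add_avgNotMem D k (b (Z.piecewise F.1 F.2) · τ) x,
      ← avgMem_add_avgNotMem D k (b ((Z.erase x).piecewise F.1 F.2) · τ) x,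
      hb.avgNotMem_eq D k x (f := (Z.erase x).piecewise F.1 F.2) (g := Z.piecewise F.1 F.2)]
    · ring
    · intro y hy
      simp [Finset.piecewise, hy]
  rw [hybrid, hybrid, ← sum_sub_distrib, sum_congr rfl fun F _ => h2 F, sum_add_distrib,
    sum_sub_distrib, h1, sub_self, add_zero]

variable {L : Finset Λ}

/-- `hell` sees its second weight only on sets avoiding x, so `swapAt x` applies again. -/
theorem sum_hell_erase (ha : IsLocal a) {Z : Finset S} {x : S} (hx : x ∈ Z) :
    ∑ F : (S → R) × (S → R), hell D k L (b ((Z.erase x).piecewise F.1 F.2)) (a F.1) x =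
      ∑ F : (S → R) × (S → R), hell D k L (b (Z.piecewise F.1 F.2)) (a F.1) x := by
  rw [← Equiv.sum_comp (swapAt x)]
  refine sum_congr rfl fun F _ => ?_
  rw [erase_piecewise_swapAt hx, hell, hell]
  refine sum_congr rfl fun τ _ => ?_
  rw [ha.avgNotMem_eq D k x (f := (swapAt x F).1) (g := F.1)]
  intro y hy
  simp [swapAt_apply, hy]

theorem sum_abs_hybrid_sub_erase_le (hk : 0 < k) (hkD : k < D.card) (ha : IsLocal a)
    (hb : IsLocal b) (wa : ∀ f, IsWeight D k (a f)) (wb : ∀ f, IsWeight D k (b f))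
    (hab : ∀ f g, IsNormalized D k L (a f) (b g)) {Z : Finset S} (hZ : Z ⊆ D) {x : S}
    (hx : x ∈ Z) {κ : ℝ} (hκ : 0 < κ) :
    ∑ τ ∈ L, |hybrid D k a b Z τ - hybrid D k a b (Z.erase x) τ| ≤
      (k / D.card) ^ 2 * (Fintype.card ((S → R) × (S → R)) * κ +
        8 / κ * ∑ F : (S → R) × (S → R), (hell D k L (a F.1) (b (Z.piecewise F.1 F.2)) x +
          hell D k L (b (Z.piecewise F.1 F.2)) (a F.1) x)) := by
  calc ∑ τ ∈ L, |hybrid D k a b Z τ - hybrid D k a b (Z.erase x) τ|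
      ≤ ∑ τ ∈ L, ∑ F : (S → R) × (S → R), |avgMem D k (a F.1 · τ) x *
        (avgMem D k (b (Z.piecewise F.1 F.2) · τ) x -
          avgMem D k (b ((Z.erase x).piecewise F.1 F.2) · τ) x)| := by
        refine sum_le_sum fun τ _ => ?_
        rw [hybrid_sub_hybrid_erase ha hb hx]
        exact abs_sum_le_sum_abs _ _
    _ = ∑ F : (S → R) × (S → R), ∑ τ ∈ L, |avgMem D k (a F.1 · τ) x *
        (avgMem D k (b (Z.piecewise F.1 F.2) · τ) x -
          avgMem D k (b ((Z.erase x).piecewise F.1 F.2) · τ) x)| := sum_comm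
    _ ≤ ∑ F : (S → R) × (S → R), (k / D.card) ^ 2 * (κ +
        (8 * hell D k L (a F.1) (b (Z.piecewise F.1 F.2)) x +
          4 * hell D k L (b (Z.piecewise F.1 F.2)) (a F.1) x +
          4 * hell D k L (b ((Z.erase x).piecewise F.1 F.2)) (a F.1) x) / κ) := by
        refine sum_le_sum fun F _ => ?_
        refine sum_abs_avgMem_mul_sub_le hk hkD (wa _) (wb _) (wb _) (hab _ _) (hab _ _) (hZ hx)
          (fun τ => hb.avgNotMem_eq D k x (fun y hy => ?_) τ) hκ
        simp [Finset.piecewise, hy]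
    -- By `sum_hell_erase` the two terms with coefficient 4 merge into one with coefficient 8.
    _ = _ := by
        rw [← mul_sum, sum_add_distrib, ← sum_div, sum_add_distrib, sum_add_distrib, ← mul_sum,
          ← mul_sum, ← mul_sum, sum_hell_erase ha hx, sum_add_distrib, sum_const, card_univ,
          nsmul_eq_mul]
        ring

theorem hell_nonneg (hkD : k ≤ D.card) {u v : Finset S → Λ → ℝ} (hv : IsWeight D k v) (x : S) :
    0 ≤ hell D k L u v x := by
  have hq : (0 : ℝ) ≤ 1 - k / D.card := by
    rw [sub_nonneg]
    exact div_le_one_of_le₀ (by exact_mod_cast hkD) (Nat.cast_nonneg _)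
  exact sum_nonneg fun τ _ => mul_nonneg
    (div_nonneg (avgNotMem_nonneg (fun Q hQ => (hv Q hQ τ).1) x) hq) (sq_nonneg _)

/-- Some element of `Z` can be made inconsistent at a low cost. -/
theorem exists_sum_abs_hybrid_sub_erase_le (hk : 0 < k) (hkD : 2 * k ≤ D.card) (ha : IsLocal a)
    (hb : IsLocal b) (wa : ∀ f, IsWeight D k (a f)) (wb : ∀ f, IsWeight D k (b f))
    (hab : ∀ f g, IsNormalized D k L (a f) (b g)) {H : ℝ} (hH : 0 < H)
    (hLH : Real.log L.card ≤ H) {Z : Finset S} (hZ : Z ⊆ D) (hne : Z.Nonempty) :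
    ∃ x ∈ Z, ∑ τ ∈ L, |hybrid D k a b Z τ - hybrid D k a b (Z.erase x) τ| ≤
      Fintype.card ((S → R) × (S → R)) * (2 * (k / D.card) ^ 2 *
        √(384 * H / (k / D.card))) / √Z.card := by
  have hk' : (0 : ℝ) < k := by exact_mod_cast hk
  have hN : (0 : ℝ) < D.card := by exact_mod_cast (by omega : 0 < D.card)
  set p : ℝ := k / D.card with hp
  have hp0 : 0 < p := by positivity
  set W : ℝ := (Fintype.card ((S → R) × (S → R)) : ℝ)
  have hW : 0 ≤ W := Nat.cast_nonneg _
  have hn : (0 : ℝ) < Z.card := by exact_mod_cast hne.card_pos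
  -- This balances the two terms: the least `e x` is at most `W * 48 * H / (p * Z.card)`, and 384 =
  -- 8 * 48.
  set κ : ℝ := √(384 * H / p) / √Z.card with hκdef
  have hκ : 0 < κ := by positivity
  have hκ2 : κ ^ 2 = 384 * H / p / Z.card := by
    rw [hκdef, div_pow, Real.sq_sqrt (by positivity), Real.sq_sqrt hn.le]
  set e : S → ℝ := fun x => ∑ F : (S → R) × (S → R),
    (hell D k L (a F.1) (b (Z.piecewise F.1 F.2)) x +
      hell D k L (b (Z.piecewise F.1 F.2)) (a F.1) x) with he
  have hesum : p * ∑ x ∈ Z, e x ≤ W * (48 * H) := by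
    have h1 : ∑ x ∈ Z, e x ≤ ∑ x ∈ D, e x :=
      sum_le_sum_of_subset_of_nonneg hZ fun x _ _ => sum_nonneg fun F _ =>
        add_nonneg (hell_nonneg (by omega) (wb _) x) (hell_nonneg (by omega) (wa _) x)
    refine (mul_le_mul_of_nonneg_left h1 hp0.le).trans ?_
    rw [he, sum_comm, mul_sum]
    have h2 : ∀ F ∈ (univ : Finset ((S → R) × (S → R))), p * ∑ x ∈ D,
        (hell D k L (a F.1) (b (Z.piecewise F.1 F.2)) x +
          hell D k L (b (Z.piecewise F.1 F.2)) (a F.1) x) ≤ 48 * H := by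
      intro F _
      rw [sum_add_distrib, mul_add]
      have h3 := sum_hell_le hk hkD (wa F.1) (wb (Z.piecewise F.1 F.2)) (hab _ _)
      have h4 := sum_hell_le hk hkD (wb (Z.piecewise F.1 F.2)) (wa F.1) (hab _ _).symm
      linarith
    refine (sum_le_sum h2).trans (le_of_eq ?_)
    rw [sum_const, card_univ, nsmul_eq_mul]
  -- The cost `e` depends on Z, so the order of removal is chosen greedily; a minimizer costs at
  -- most the average.
  obtain ⟨x, hx, hmin⟩ := exists_min_image Z e hne
  refine ⟨x, hx, (sum_abs_hybrid_sub_erase_le hk (by omega) ha hb wa wb hab hZ hx hκ).trans ?_⟩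
  have h1 : Z.card * e x ≤ ∑ x ∈ Z, e x := by
    rw [← nsmul_eq_mul]
    exact card_nsmul_le_sum _ _ _ hmin
  have h2 : 8 / κ * e x ≤ W * κ := by
    rw [div_mul_eq_mul_div, div_le_iff₀ hκ, mul_assoc, ← sq, hκ2]
    have h3 : p * (Z.card * e x) ≤ W * (48 * H) :=
      (mul_le_mul_of_nonneg_left h1 hp0.le).trans hesum
    rw [div_div, mul_div_assoc', le_div_iff₀ (by positivity)]
    linarith
  calc p ^ 2 * (W * κ + 8 / κ * e x) ≤ p ^ 2 * (W * κ + W * κ) := by gcongr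
    _ = _ := by rw [hκdef]; ring

theorem sum_abs_hybrid_sub_le (hk : 0 < k) (hkD : 2 * k ≤ D.card) (ha : IsLocal a)
    (hb : IsLocal b) (wa : ∀ f, IsWeight D k (a f)) (wb : ∀ f, IsWeight D k (b f))
    (hab : ∀ f g, IsNormalized D k L (a f) (b g)) {H : ℝ} (hH : 0 < H)
    (hLH : Real.log L.card ≤ H) (n : ℕ) {Z : Finset S} (hZ : Z ⊆ D) (hn : Z.card = n) :
    ∑ τ ∈ L, |hybrid D k a b Z τ - hybrid D k a b ∅ τ| ≤
      Fintype.card ((S → R) × (S → R)) * (2 * (k / D.card) ^ 2 *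
        √(384 * H / (k / D.card))) * (2 * √n) := by
  induction n generalizing Z with
  | zero =>
    rw [card_eq_zero] at hn
    simp [hn]
  | succ n ih =>
    obtain ⟨x, hx, hstep⟩ := exists_sum_abs_hybrid_sub_erase_le hk hkD ha hb wa wb hab hH hLH hZ
      (card_pos.1 (by omega))
    have hrec := ih ((erase_subset x Z).trans hZ) (by rw [card_erase_of_mem hx, hn]; rfl)
    rw [hn] at hstep
    set c : ℝ := (Fintype.card ((S → R) × (S → R)) : ℝ) * (2 * (k / D.card) ^ 2 *
        √(384 * H / (k / D.card)))
    have hc : 0 ≤ c := by positivity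
    -- The telescoping form of `∑ 1/√m ≤ 2√n`.
    have hs : 2 * √(n : ℝ) + 1 / √((n + 1 : ℕ) : ℝ) ≤ 2 * √((n + 1 : ℕ) : ℝ) := by
      have h1 := Real.sq_sqrt (Nat.cast_nonneg n : (0 : ℝ) ≤ n)
      have h2 := Real.sq_sqrt (Nat.cast_nonneg (n + 1) : (0 : ℝ) ≤ ((n + 1 : ℕ) : ℝ))
      have h3 : 0 < √((n + 1 : ℕ) : ℝ) := Real.sqrt_pos.2 (by positivity)
      rw [← le_sub_iff_add_le', div_le_iff₀ h3]
      push_cast at h2 h3 ⊢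
      nlinarith [sq_nonneg (√(n : ℝ) - √((n : ℝ) + 1))]
    calc ∑ τ ∈ L, |hybrid D k a b Z τ - hybrid D k a b ∅ τ|
        ≤ ∑ τ ∈ L, (|hybrid D k a b Z τ - hybrid D k a b (Z.erase x) τ| +
          |hybrid D k a b (Z.erase x) τ - hybrid D k a b ∅ τ|) :=
          sum_le_sum fun τ _ => abs_sub_le _ _ _
      _ ≤ c / √((n + 1 : ℕ) : ℝ) + c * (2 * √(n : ℝ)) := by
          rw [sum_add_distrib]
          exact add_le_add hstep hrec
      _ = c * (2 * √(n : ℝ) + 1 / √((n + 1 : ℕ) : ℝ)) := by ring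
      _ ≤ _ := mul_le_mul_of_nonneg_left hs hc

/-- A protocol with few transcripts can hardly distinguish an oracle that is common to the parties
from two independent oracles. -/
theorem sq_sum_abs_hybrid_sub_le (hk : 0 < k) (hkD : 2 * k ≤ D.card) (ha : IsLocal a)
    (hb : IsLocal b) (wa : ∀ f, IsWeight D k (a f)) (wb : ∀ f, IsWeight D k (b f))
    (hab : ∀ f g, IsNormalized D k L (a f) (b g)) {H : ℝ} (hH : 0 < H)
    (hLH : Real.log L.card ≤ H) :
    (∑ τ ∈ L, |hybrid D k a b D τ - hybrid D k a b ∅ τ|) ^ 2 ≤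
      (Fintype.card ((S → R) × (S → R)) : ℝ) ^ 2 * (6144 * H * k ^ 3 / D.card ^ 2) := by
  have hk' : (0 : ℝ) < k := by exact_mod_cast hk
  have hN : (0 : ℝ) < D.card := by exact_mod_cast (by omega : 0 < D.card)
  have h := sum_abs_hybrid_sub_le hk hkD ha hb wa wb hab hH hLH _ subset_rfl rfl
  -- The constant is 6144 = 2² * 384 * 2².
  refine (pow_le_pow_left₀ (sum_nonneg fun _ _ => abs_nonneg _) h 2).trans (le_of_eq ?_)
  simp only [mul_pow]
  rw [Real.sq_sqrt (by positivity), Real.sq_sqrt hN.le]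
  field_simp
  ring

end Hybrid

end KeyAgreement

namespace KeyAgreement

open Finset

/-! ### Discrete probability. -/

section Prob

variable {Ω Ω₁ Ω₂ ι : Type*}

theorem prob_nonneg (p : PMF Ω) (E : Set Ω) : 0 ≤ prob p E :=
  ENNReal.toReal_nonneg

theorem prob_congr (p : PMF Ω) {E E' : Set Ω} (h : ∀ r ∈ p.support, r ∈ E ↔ r ∈ E') :
    prob p E = prob p E' := by
  rw [prob, prob, p.toOuterMeasure_apply_eq_of_inter_support_eq]
  ext r
  simp only [Set.mem_inter_iff]
  exact and_congr_left (h r)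

theorem toOuterMeasure_le_one (p : PMF Ω) (E : Set Ω) : p.toOuterMeasure E ≤ 1 := by
  rw [PMF.toOuterMeasure_apply, ← p.tsum_coe]
  exact ENNReal.tsum_le_tsum fun r => Set.indicator_le_self _ _ r

theorem toOuterMeasure_ne_top (p : PMF Ω) (E : Set Ω) : p.toOuterMeasure E ≠ ⊤ :=
  ((toOuterMeasure_le_one p E).trans_lt ENNReal.one_lt_top).ne

theorem prob_mono (p : PMF Ω) {E E' : Set Ω} (h : E ⊆ E') : prob p E ≤ prob p E' :=
  ENNReal.toReal_mono (toOuterMeasure_ne_top p E') (p.toOuterMeasure.mono h)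

theorem prob_eq_sum (p : PMF Ω) (E : Set Ω) [DecidableEq ι] (X : Ω → ι) (s : Finset ι)
    (h : ∀ r ∈ p.support, r ∈ E → X r ∈ s) :
    prob p E = ∑ i ∈ s, prob p {r | r ∈ E ∧ X r = i} := by
  classical
  simp only [prob]
  rw [← ENNReal.toReal_sum fun i _ => toOuterMeasure_ne_top p _]
  congr 1
  simp only [PMF.toOuterMeasure_apply]
  rw [← Summable.tsum_finsetSum fun i _ => ENNReal.summable]
  refine tsum_congr fun r => ?_
  simp only [Set.indicator_apply, Set.mem_ofPred_eq]
  by_cases hr : r ∈ E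
  · simp only [hr, if_true, true_and, sum_ite_eq]
    split_ifs with hX
    · rfl
    · by_contra h0
      exact hX (h r (p.mem_support_iff r |>.2 h0) hr)
  · simp [hr]

theorem toOuterMeasure_indep (p : PMF Ω₁) (p' : PMF Ω₂) (E : Set (Ω₁ × Ω₂)) :
    (indep p p').toOuterMeasure E = ∑' a, p a * p'.toOuterMeasure {b | (a, b) ∈ E} := by
  rw [indep, PMF.toOuterMeasure_bind_apply]
  refine tsum_congr fun a => ?_
  rw [PMF.toOuterMeasure_map_apply]
  rfl

theorem prob_indep_prod (p : PMF Ω₁) (p' : PMF Ω₂) (E : Set Ω₁) (E' : Set Ω₂) :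
    prob (indep p p') {r | r.1 ∈ E ∧ r.2 ∈ E'} = prob p E * prob p' E' := by
  classical
  rw [prob, toOuterMeasure_indep, prob, prob, ← ENNReal.toReal_mul, PMF.toOuterMeasure_apply,
    ← ENNReal.tsum_mul_right]
  congr 1
  refine tsum_congr fun a => ?_
  by_cases ha : a ∈ E
  · simp [ha]
  · simp [ha]

theorem prob_indep_uniform [Fintype Ω₁] [Nonempty Ω₁] (p' : PMF Ω₂) (E : Set (Ω₁ × Ω₂)) :
    prob (indep (PMF.uniformOfFintype Ω₁) p') E =
      (∑ a, prob p' {b | (a, b) ∈ E}) / Fintype.card Ω₁ := by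
  rw [prob, toOuterMeasure_indep, tsum_fintype, ENNReal.toReal_sum, sum_div]
  · refine sum_congr rfl fun a _ => ?_
    rw [ENNReal.toReal_mul, PMF.uniformOfFintype_apply, prob, ENNReal.toReal_inv,
      ENNReal.toReal_natCast, div_eq_inv_mul]
  · intro a _
    exact ENNReal.mul_ne_top (PMF.apply_ne_top _ _) (toOuterMeasure_ne_top _ _)

theorem prob_map_eq_of_map_eq_uniform {p : PMF Ω} {X : Ω → ι} {s : Finset ι} {h : s.Nonempty}
    (hX : p.map X = PMF.uniformOfFinset s h) {i : ι} (hi : i ∈ s) :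
    prob p {r | X r = i} = (s.card : ℝ)⁻¹ := by
  have h1 : prob p {r | X r = i} = ((p.map X) i).toReal := by
    rw [← PMF.toOuterMeasure_apply_singleton, PMF.toOuterMeasure_map_apply]
    rfl
  rw [h1, hX, PMF.uniformOfFinset_apply_of_mem h hi, ENNReal.toReal_inv, ENNReal.toReal_natCast]

theorem mem_of_map_eq_uniform {p : PMF Ω} {X : Ω → ι} {s : Finset ι} {h : s.Nonempty}
    (hX : p.map X = PMF.uniformOfFinset s h) {r : Ω} (hr : r ∈ p.support) : X r ∈ s := by
  rw [← PMF.mem_support_uniformOfFinset_iff h, ← hX, PMF.mem_support_map_iff]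
  exact ⟨r, hr, rfl⟩

end Prob

/-! ### The rectangle property and truncation. -/

namespace Interaction

variable {U V : Type*}

/-- The local data `u` of `A` is consistent with the transcript `t` and the output `o` of `A`. -/
def ConsA : Interaction U V → U → List Bool → Bool → Prop
  | output oA _, u, [], o => oA u = o
  | output _ _, _, _ :: _, _ => False
  | sendA _ _, _, [], _ => False
  | sendA msg next, u, b :: t, o => msg u = b ∧ (next b).ConsA u t o
  | sendB _ _, _, [], _ => False
  | sendB _ next, u, b :: t, o => (next b).ConsA u t o

/-- The local data `v` of `B` is consistent with the transcript `t` and the output `o` of `B`. -/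
def ConsB : Interaction U V → V → List Bool → Bool → Prop
  | output _ oB, v, [], o => oB v = o
  | output _ _, _, _ :: _, _ => False
  | sendA _ _, _, [], _ => False
  | sendA _ next, v, b :: t, o => (next b).ConsB v t o
  | sendB _ _, _, [], _ => False
  | sendB msg next, v, b :: t, o => msg v = b ∧ (next b).ConsB v t o

/-- The rectangle property: the transcript and the outputs are described by two independent
conditions on the data of the parties. -/
theorem transcript_outputs_eq_iff (T : Interaction U V) (u : U) (v : V)
    (τ : List Bool × Bool × Bool) :
    (T.transcript u v, T.outA u v, T.outB u v) = τ ↔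
      T.ConsA u τ.1 τ.2.1 ∧ T.ConsB v τ.1 τ.2.2 := by
  obtain ⟨t, o, o'⟩ := τ
  simp only [Prod.mk.injEq]
  induction T generalizing t with
  | output oA oB => cases t <;> simp [transcript, outA, outB, ConsA, ConsB]
  | sendA msg next ih =>
    cases t with
    | nil => simp [transcript, ConsA]
    | cons b t =>
      simp only [transcript, outA, outB, ConsA, ConsB, List.cons.injEq, and_assoc]
      constructor
      · rintro ⟨rfl, h⟩
        exact ⟨rfl, (ih _ t).1 h⟩
      · rintro ⟨rfl, h⟩
        exact ⟨rfl, (ih _ t).2 h⟩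
  | sendB msg next ih =>
    cases t with
    | nil => simp [transcript, ConsA]
    | cons b t =>
      simp only [transcript, outA, outB, ConsA, ConsB, List.cons.injEq, and_assoc]
      constructor
      · rintro ⟨rfl, h⟩
        have := (ih _ t).1 h
        exact ⟨this.1, rfl, this.2⟩
      · rintro ⟨h1, rfl, h2⟩
        exact ⟨rfl, (ih _ t).2 ⟨h1, h2⟩⟩

/-- The interaction that is cut off after `n` bits. -/
def trunc : ℕ → Interaction U V → Interaction U V
  | _, output oA oB => output oA oB
  | 0, sendA _ _ => output (fun _ => false) fun _ => false
  | 0, sendB _ _ => output (fun _ => false) fun _ => false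
  | n + 1, sendA msg next => sendA msg fun b => (next b).trunc n
  | n + 1, sendB msg next => sendB msg fun b => (next b).trunc n

/-- `CC` bounds only executions with one oracle. Data from two different oracles may lead to longer
transcripts, and truncation keeps the same small set of leaves for all hybrids. -/
theorem length_transcript_trunc_le (n : ℕ) (T : Interaction U V) (u : U) (v : V) :
    ((T.trunc n).transcript u v).length ≤ n := by
  induction T generalizing n with
  | output oA oB => cases n <;> simp [trunc, transcript]
  | sendA msg next ih => cases n <;> simp [trunc, transcript, ih]
  | sendB msg next ih => cases n <;> simp [trunc, transcript, ih]

theorem trunc_eq (n : ℕ) (T : Interaction U V) (u : U) (v : V)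
    (h : (T.transcript u v).length ≤ n) :
    (T.trunc n).transcript u v = T.transcript u v ∧ (T.trunc n).outA u v = T.outA u v ∧
      (T.trunc n).outB u v = T.outB u v := by
  induction T generalizing n with
  | output oA oB => cases n <;> simp [trunc]
  | sendA msg next ih =>
    cases n with
    | zero => simp [transcript] at h
    | succ n =>
      simp only [transcript, List.length_cons, Nat.add_le_add_iff_right] at h
      simpa [trunc, transcript, outA, outB] using ih _ n h
  | sendB msg next ih =>
    cases n with
    | zero => simp [transcript] at h
    | succ n =>
      simp only [transcript, List.length_cons, Nat.add_le_add_iff_right] at h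
      simpa [trunc, transcript, outA, outB] using ih _ n h

end Interaction

/-! ### Counting leaves. -/

/-- The bit strings of length at most `n`. -/
def bitLists : ℕ → Finset (List Bool)
  | 0 => {[]}
  | n + 1 => insert [] ((bitLists n).image (true :: ·) ∪ (bitLists n).image (false :: ·))

theorem mem_bitLists {n : ℕ} {t : List Bool} (h : t.length ≤ n) : t ∈ bitLists n := by
  induction n generalizing t with
  | zero => simpa [bitLists] using h
  | succ n ih =>
    cases t with
    | nil => simp [bitLists]
    | cons b t =>
      have := ih (t := t) (by simpa using h)
      cases b <;> simp [bitLists, this]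

/-- Strictness carries the induction: it leaves room for the empty string. -/
theorem card_bitLists_lt (n : ℕ) : (bitLists n).card < 2 ^ (n + 1) := by
  induction n with
  | zero => simp [bitLists]
  | succ n ih =>
    have h1 := card_insert_le [] ((bitLists n).image (true :: ·) ∪ (bitLists n).image (false :: ·))
    have h2 := card_union_le ((bitLists n).image (true :: ·)) ((bitLists n).image (false :: ·))
    have h3 : ((bitLists n).image (true :: ·)).card ≤ _ := card_image_le
    have h4 : ((bitLists n).image (false :: ·)).card ≤ _ := card_image_le
    rw [pow_succ]
    simp only [bitLists]
    omega

/-- The transcripts of at most `n` bits, together with the outputs of both parties. -/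
def leaves (n : ℕ) : Finset (List Bool × Bool × Bool) :=
  bitLists n ×ˢ univ

theorem log_card_leaves_le (n : ℕ) : Real.log (leaves n).card ≤ 4 * max 1 (n : ℝ) := by
  -- The four output pairs contribute a factor 4. They remain when no bit is sent, which is why the
  -- final bound has `max 1`.
  have h1 : (leaves n).card ≤ 2 ^ (n + 3) := by
    have := card_bitLists_lt n
    simp only [leaves, card_product, card_univ, Fintype.card_prod, Fintype.card_bool]
    rw [pow_succ] at this
    rw [pow_add]
    omega
  have hn : (0 : ℝ) ≤ n := Nat.cast_nonneg n
  have h2 : Real.log (leaves n).card ≤ (n + 3) * Real.log 2 := by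
    rcases Nat.eq_zero_or_pos (leaves n).card with h | h
    · rw [h, Nat.cast_zero, Real.log_zero]
      have := Real.log_nonneg one_le_two
      positivity
    · have h3 : ((leaves n).card : ℝ) ≤ 2 ^ (n + 3) := by exact_mod_cast h1
      have h4 := Real.log_le_log (by exact_mod_cast h) h3
      rw [Real.log_pow] at h4
      exact_mod_cast h4
  have h3 : Real.log 2 ≤ 1 := by linarith [Real.log_two_lt_d9]
  have h4 := le_max_left 1 (n : ℝ)
  have h5 := le_max_right 1 (n : ℝ)
  nlinarith

/-! ### Nonadaptive eavesdroppers. -/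

namespace OracleAlgorithm

variable {S R : Type*} [DecidableEq S]

/-- The algorithm that queries all elements of a list, and then applies `G` to the oracle `h`
updated by the answers. -/
def queryList : List S → (S → R) → ((S → R) → Bool) → OracleAlgorithm S R
  | [], h, G => answer (G h)
  | x :: l, h, G => query x fun y => queryList l (Function.update h x y) G

theorem numQueries_queryList (f : S → R) (l : List S) (h : S → R) (G : (S → R) → Bool) :
    (queryList l h G).numQueries f = l.length := by
  induction l generalizing h with
  | nil => rfl
  | cons x l ih => simp [queryList, numQueries, ih]

theorem eval_queryList (f : S → R) (l : List S) (h : S → R) (G : (S → R) → Bool) :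
    (queryList l h G).eval f = G fun y => if y ∈ l then f y else h y := by
  induction l generalizing h with
  | nil => simp [queryList, eval]
  | cons x l ih =>
    rw [queryList, eval, ih]
    congr 1
    ext y
    by_cases h1 : y ∈ l
    · simp [h1]
    · by_cases h2 : y = x
      · subst h2
        simp
      · simp [h1, h2]

end OracleAlgorithm

end KeyAgreement

namespace KeyAgreement

open Finset

/-! ### Transcript weights of a protocol. -/

section Weight

variable {S R Ω Λ : Type*} [DecidableEq S]

/-- The probability that the private coins of a party are consistent with `τ`, given that its query
set is `Q`, when the probability of each possible query set is `1 / M`. -/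
noncomputable def weight (p : PMF Ω) (q : Ω → Finset S) (M : ℝ) (c : (S → R) → Ω → Λ → Prop)
    (f : S → R) (Q : Finset S) (τ : Λ) : ℝ :=
  M * prob p {r | c f r τ ∧ q r = Q}

variable {p : PMF Ω} {q : Ω → Finset S} {c : (S → R) → Ω → Λ → Prop} {D : Finset S} {k : ℕ}

theorem isLocal_weight (M : ℝ)
    (hc : ∀ f g r, (∀ x ∈ q r, f x = g x) → c f r = c g r) : IsLocal (weight p q M c) := by
  intro f g Q hfg
  ext τ
  rw [weight, weight]
  congr 2
  ext r
  simp only [Set.mem_ofPred_eq]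
  refine and_congr_left fun h => ?_
  rw [hc f g r (h ▸ hfg)]

variable {hne : (D.powersetCard k).Nonempty}

theorem isWeight_weight (hq : p.map q = PMF.uniformOfFinset (D.powersetCard k) hne) (f : S → R) :
    IsWeight D k (weight p q (D.card.choose k) c f) := by
  intro Q hQ τ
  have hM : (0 : ℝ) < D.card.choose k := by
    rw [← card_powersetCard]
    exact_mod_cast hne.card_pos
  refine ⟨mul_nonneg hM.le (prob_nonneg _ _), ?_⟩
  have h := prob_map_eq_of_map_eq_uniform hq hQ
  rw [card_powersetCard] at h
  calc _ ≤ (D.card.choose k : ℝ) * (D.card.choose k : ℝ)⁻¹ := by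
        rw [← h]
        exact mul_le_mul_of_nonneg_left (prob_mono p fun r hr => hr.2) hM.le
    _ = 1 := mul_inv_cancel₀ hM.ne'

theorem avg_weight (hq : p.map q = PMF.uniformOfFinset (D.powersetCard k) hne) (f : S → R)
    (τ : Λ) : avg D k (weight p q (D.card.choose k) c f · τ) = prob p {r | c f r τ} := by
  have hM : (0 : ℝ) < D.card.choose k := by
    rw [← card_powersetCard]
    exact_mod_cast hne.card_pos
  simp only [avg, weight]
  rw [← mul_sum, mul_div_cancel_left₀ _ hM.ne',
    prob_eq_sum p {r | c f r τ} q (D.powersetCard k) fun r hr _ => mem_of_map_eq_uniform hq hr]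
  rfl

end Weight

/-- The guess of the output of `A` from the transcript that is most likely, when `A t o` is the
weight of the output `o` together with the transcript `t`. -/
noncomputable def bestGuess (A : List Bool → Bool → ℝ) (t : List Bool) : Bool :=
  open Classical in decide (A t false ≤ A t true)

/-- For a fixed transcript the weight is a product, so agreement has weight at most `max A * (B true
+ B false)`, the success weight of the guess. -/
theorem sum_eq_le_sum_bestGuess (n : ℕ) (A B : List Bool → Bool → ℝ) (hB : ∀ t o, 0 ≤ B t o) :
    ∑ τ ∈ leaves n, (if τ.2.1 = τ.2.2 then A τ.1 τ.2.1 * B τ.1 τ.2.2 else 0) ≤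
      ∑ τ ∈ leaves n,
        (if bestGuess A τ.1 = τ.2.1 then A τ.1 τ.2.1 * B τ.1 τ.2.2 else 0) := by
  rw [leaves, sum_product, sum_product]
  refine sum_le_sum fun t _ => ?_
  have h1 := hB t true
  have h2 := hB t false
  simp only [Fintype.sum_prod_type, Fintype.sum_bool]
  by_cases h : A t false ≤ A t true
  · have : bestGuess A t = true := by simp [bestGuess, h]
    simp [this]
    nlinarith
  · have : bestGuess A t = false := by simp [bestGuess, h]
    simp [this]
    nlinarith

/-! ### Leaf distributions of a protocol. -/

namespace NonAdaptiveProtocol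

variable {S R ΩA ΩB : Type*} (P : NonAdaptiveProtocol S R ΩA ΩB)

/-- The coins `r` of `A` are consistent with a transcript and an output of `A` when the oracle of
`A` is `f`, and the interaction is cut off after `P.CC` bits. -/
def ConsA (f : S → R) (r : ΩA) (τ : List Bool × Bool × Bool) : Prop :=
  (P.interaction.trunc P.CC).ConsA (P.dataA f r) τ.1 τ.2.1

/-- The coins `r` of `B` are consistent with a transcript and an output of `B` when the oracle of
`B` is `f`, and the interaction is cut off after `P.CC` bits. -/
def ConsB (f : S → R) (r : ΩB) (τ : List Bool × Bool × Bool) : Prop :=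
  (P.interaction.trunc P.CC).ConsB (P.dataB f r) τ.1 τ.2.2

/-- The transcript and the outputs when the oracle of `A` is `f`, the oracle of `B` is `g`, and the
interaction is cut off after `P.CC` bits. -/
noncomputable def leaf (f g : S → R) (r : ΩA × ΩB) : List Bool × Bool × Bool :=
  ((P.interaction.trunc P.CC).transcript (P.dataA f r.1) (P.dataB g r.2),
    (P.interaction.trunc P.CC).outA (P.dataA f r.1) (P.dataB g r.2),
    (P.interaction.trunc P.CC).outB (P.dataA f r.1) (P.dataB g r.2))

theorem leaf_mem (f g : S → R) (r : ΩA × ΩB) : P.leaf f g r ∈ leaves P.CC := by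
  rw [leaves, mem_product]
  exact ⟨mem_bitLists (Interaction.length_transcript_trunc_le _ _ _ _), mem_univ _⟩

theorem leaf_eq_iff (f g : S → R) (r : ΩA × ΩB) (τ : List Bool × Bool × Bool) :
    P.leaf f g r = τ ↔ P.ConsA f r.1 τ ∧ P.ConsB g r.2 τ :=
  Interaction.transcript_outputs_eq_iff _ _ _ _

theorem leaf_self (f : S → R) {r : ΩA × ΩB} (hr : r ∈ P.coins.support) :
    P.leaf f f r = (P.trans f r, P.outA f r, P.outB f r) := by
  have h : (P.trans f r).length ≤ P.CC := le_csSup P.bddAbove_transcriptLengths ⟨f, r, hr, rfl⟩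
  obtain ⟨h1, h2, h3⟩ := Interaction.trunc_eq _ _ _ _ h
  simp only [leaf, trans, outA, outB, h1, h2, h3]

theorem ConsA_congr {f g : S → R} {r : ΩA} (h : ∀ x ∈ P.queriesA r, f x = g x) :
    P.ConsA f r = P.ConsA g r := by
  have : P.dataA f r = P.dataA g r := by
    simp only [dataA]
    congr 1
    ext x
    exact h x x.2
  ext τ
  rw [ConsA, ConsA, this]

theorem ConsB_congr {f g : S → R} {r : ΩB} (h : ∀ x ∈ P.queriesB r, f x = g x) :
    P.ConsB f r = P.ConsB g r := by
  have : P.dataB f r = P.dataB g r := by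
    simp only [dataB]
    congr 1
    ext x
    exact h x x.2
  ext τ
  rw [ConsB, ConsB, this]

/-- The probability that `A`, with oracle `f`, is consistent with `τ`. -/
noncomputable def probA (f : S → R) (τ : List Bool × Bool × Bool) : ℝ :=
  prob P.coinsA {r | P.ConsA f r τ}

/-- The probability that `B`, with oracle `f`, is consistent with `τ`. -/
noncomputable def probB (f : S → R) (τ : List Bool × Bool × Bool) : ℝ :=
  prob P.coinsB {r | P.ConsB f r τ}

theorem prob_coins_eq_sum (f : S → R) (G : List Bool × Bool × Bool → Prop) [DecidablePred G] :
    prob P.coins {r | G (P.trans f r, P.outA f r, P.outB f r)} =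
      ∑ τ ∈ leaves P.CC, if G τ then P.probA f τ * P.probB f τ else 0 := by
  have h1 : prob P.coins {r | G (P.trans f r, P.outA f r, P.outB f r)} =
      prob P.coins {r | G (P.leaf f f r)} :=
    prob_congr _ fun r hr => by simp only [Set.mem_ofPred_eq, P.leaf_self f hr]
  rw [h1, prob_eq_sum P.coins _ (P.leaf f f) (leaves P.CC) fun r _ _ => P.leaf_mem f f r]
  refine sum_congr rfl fun τ _ => ?_
  split_ifs with h
  · rw [probA, probB, ← prob_indep_prod]
    refine prob_congr _ fun r _ => ?_
    simp only [Set.mem_ofPred_eq, ← P.leaf_eq_iff]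
    constructor
    · exact fun hr => hr.2
    · rintro rfl
      exact ⟨h, rfl⟩
  · have : {r | r ∈ {r | G (P.leaf f f r)} ∧ P.leaf f f r = τ} = (∅ : Set (ΩA × ΩB)) := by
      ext r
      simp only [Set.mem_ofPred_eq, Set.mem_empty_iff_false, iff_false, not_and]
      rintro hr rfl
      exact h hr
    rw [this, prob]
    simp

variable {P} {D : Finset S} {ℓ : ℕ}

/-- Holds for different oracles too, because the truncated leaf always lies in `leaves P.CC`. -/
theorem isNormalized_weight [DecidableEq S] {hne : (D.powersetCard ℓ).Nonempty}
    (hA : P.coinsA.map P.queriesA = PMF.uniformOfFinset (D.powersetCard ℓ) hne)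
    (hB : P.coinsB.map P.queriesB = PMF.uniformOfFinset (D.powersetCard ℓ) hne) (f g : S → R) :
    IsNormalized D ℓ (leaves P.CC) (weight P.coinsA P.queriesA (D.card.choose ℓ) P.ConsA f)
      (weight P.coinsB P.queriesB (D.card.choose ℓ) P.ConsB g) := by
  intro Q hQ Q' hQ'
  have hM : (0 : ℝ) < D.card.choose ℓ := by
    rw [← card_powersetCard]
    exact_mod_cast hne.card_pos
  have h := prob_indep_prod P.coinsA P.coinsB {r | P.queriesA r = Q} {r | P.queriesB r = Q'}
  rw [prob_map_eq_of_map_eq_uniform hA hQ, prob_map_eq_of_map_eq_uniform hB hQ',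
    card_powersetCard, prob_eq_sum _ _ (P.leaf f g) (leaves P.CC) fun r _ _ => P.leaf_mem f g r] at h
  have h2 : ∀ τ ∈ leaves P.CC, weight P.coinsA P.queriesA (D.card.choose ℓ) P.ConsA f Q τ *
      weight P.coinsB P.queriesB (D.card.choose ℓ) P.ConsB g Q' τ =
      (D.card.choose ℓ : ℝ) ^ 2 * prob (indep P.coinsA P.coinsB)
        {r | r ∈ {r : ΩA × ΩB | r.1 ∈ {r | P.queriesA r = Q} ∧ r.2 ∈ {r | P.queriesB r = Q'}} ∧
          P.leaf f g r = τ} := by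
    intro τ _
    rw [weight, weight, mul_mul_mul_comm, ← prob_indep_prod, ← sq]
    congr 2
    ext r
    simp only [Set.mem_ofPred_eq, P.leaf_eq_iff]
    tauto
  rw [sum_congr rfl h2, ← mul_sum, h]
  field_simp

/-! ### The two eavesdroppers and the final bound. -/

section Finite

variable [Fintype S] [DecidableEq S] [Fintype R] [Nonempty R] {q : ℕ} {α γ : ℝ}

/-- An eavesdropper that can query the whole query domain breaks the protocol. -/
theorem one_sub_le_of_card_le (hP : P.IsUniformQuery D ℓ) (hK : P.IsKeyAgreement q α γ)
    (hq : D.card ≤ q) : 1 - α ≤ γ := by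
  obtain ⟨hne, hA, -⟩ := hP
  have hprob : ∀ f g : S → R, (∀ x ∈ D, f x = g x) → P.probA f = P.probA g := by
    intro f g hfg
    ext τ
    refine prob_congr _ fun r hr => ?_
    have hQ := (mem_powersetCard.1 (mem_of_map_eq_uniform hA hr)).1
    simp only [Set.mem_ofPred_eq]
    rw [P.ConsA_congr fun x hx => hfg x (hQ hx)]
  let f₀ : S → R := fun _ => Classical.arbitrary R
  -- For a fixed oracle the coins are independent, so the best guess applies. `probA` ignores the
  -- output of `B`, so `(t, o, o)` is a harmless representative; by `hprob` the values of `f₀` off D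
  -- do not matter.
  let guess : (S → R) → List Bool → Bool := fun f => bestGuess fun t o => P.probA f (t, o, o)
  let E : List Bool → OracleAlgorithm S R := fun t =>
    OracleAlgorithm.queryList D.toList f₀ fun f => guess f t
  have hE : ∀ t f, (E t).eval f = guess f t := by
    intro t f
    simp only [E, guess, OracleAlgorithm.eval_queryList]
    rw [hprob _ f]
    intro x hx
    simp [hx]
  have hsec := hK.secrecy E fun t f => by
    simp only [E, OracleAlgorithm.numQueries_queryList, length_toList]
    exact hq
  rw [prob_indep_uniform] at hsec
  refine le_trans ?_ hsec
  have hW : (0 : ℝ) < Fintype.card (S → R) := Nat.cast_pos.2 Fintype.card_pos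
  rw [le_div_iff₀ hW]
  have hpt : ∀ f ∈ (univ : Finset (S → R)), 1 - α ≤ prob P.coins
      {r | (f, r) ∈ {v : (S → R) × ΩA × ΩB |
        (E (P.trans v.1 v.2)).eval v.1 = P.outA v.1 v.2}} := by
    intro f _
    refine (hK.accuracy f).trans ?_
    have h1 := P.prob_coins_eq_sum f fun τ => τ.2.1 = τ.2.2
    have h2 := P.prob_coins_eq_sum f fun τ => guess f τ.1 = τ.2.1
    simp only [Set.mem_ofPred_eq, hE]
    simp only at h1 h2
    rw [h1, h2]
    exact sum_eq_le_sum_bestGuess _ (fun t o => P.probA f (t, o, o))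
      (fun t o => P.probB f (t, o, o)) fun t o => prob_nonneg _ _
  have := sum_le_sum hpt
  rw [sum_const, card_univ, nsmul_eq_mul] at this
  linarith

/-- All queries lie in D, so at `Z = D` both parties use the first oracle, and the second one only
contributes a factor. -/
theorem sum_probA_mul_probB_eq {hne : (D.powersetCard ℓ).Nonempty}
    (hA : P.coinsA.map P.queriesA = PMF.uniformOfFinset (D.powersetCard ℓ) hne)
    (hB : P.coinsB.map P.queriesB = PMF.uniformOfFinset (D.powersetCard ℓ) hne)
    (τ : List Bool × Bool × Bool) :
    hybrid D ℓ (weight P.coinsA P.queriesA (D.card.choose ℓ) P.ConsA)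
      (weight P.coinsB P.queriesB (D.card.choose ℓ) P.ConsB) D τ =
      Fintype.card (S → R) * ∑ f, P.probA f τ * P.probB f τ := by
  simp only [hybrid, avg_weight hA, avg_weight hB]
  have h : ∀ F : (S → R) × (S → R), prob P.coinsB {r | P.ConsB (D.piecewise F.1 F.2) r τ} =
      P.probB F.1 τ := by
    intro F
    refine prob_congr _ fun r hr => ?_
    have hQ := (mem_powersetCard.1 (mem_of_map_eq_uniform hB hr)).1
    simp only [Set.mem_ofPred_eq]
    rw [P.ConsB_congr fun x hx => D.piecewise_eq_of_mem F.1 F.2 (hQ hx)]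
  simp only [h]
  rw [Fintype.sum_prod_type, mul_sum]
  refine sum_congr rfl fun f _ => ?_
  simp [probA]

theorem sum_probA_mul_sum_probB_eq {hne : (D.powersetCard ℓ).Nonempty}
    (hA : P.coinsA.map P.queriesA = PMF.uniformOfFinset (D.powersetCard ℓ) hne)
    (hB : P.coinsB.map P.queriesB = PMF.uniformOfFinset (D.powersetCard ℓ) hne)
    (τ : List Bool × Bool × Bool) :
    hybrid D ℓ (weight P.coinsA P.queriesA (D.card.choose ℓ) P.ConsA)
      (weight P.coinsB P.queriesB (D.card.choose ℓ) P.ConsB) ∅ τ =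
      (∑ f, P.probA f τ) * ∑ f, P.probB f τ := by
  simp only [hybrid, avg_weight hA, avg_weight hB, piecewise_empty, sum_mul_sum]
  rw [Fintype.sum_prod_type]
  rfl

/-- An eavesdropper that makes no queries succeeds, up to the distance between the protocol with a
common oracle and the protocol with independent oracles. -/
theorem one_sub_sub_le_sum_abs_hybrid {hne : (D.powersetCard ℓ).Nonempty}
    (hA : P.coinsA.map P.queriesA = PMF.uniformOfFinset (D.powersetCard ℓ) hne)
    (hB : P.coinsB.map P.queriesB = PMF.uniformOfFinset (D.powersetCard ℓ) hne)
    (hK : P.IsKeyAgreement q α γ) :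
    Fintype.card ((S → R) × (S → R)) * (1 - α - γ) ≤
      ∑ τ ∈ leaves P.CC,
        |hybrid D ℓ (weight P.coinsA P.queriesA (D.card.choose ℓ) P.ConsA)
            (weight P.coinsB P.queriesB (D.card.choose ℓ) P.ConsB) D τ -
          hybrid D ℓ (weight P.coinsA P.queriesA (D.card.choose ℓ) P.ConsA)
            (weight P.coinsB P.queriesB (D.card.choose ℓ) P.ConsB) ∅ τ| := by
  let A : List Bool → Bool → ℝ := fun t o => ∑ f, P.probA f (t, o, o)
  let B : List Bool → Bool → ℝ := fun t o => ∑ f, P.probB f (t, o, o)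
  let W : ℝ := Fintype.card (S → R)
  have hW : 0 < W := Nat.cast_pos.2 Fintype.card_pos
  let X : List Bool × Bool × Bool → ℝ := fun τ => W * ∑ f, P.probA f τ * P.probB f τ
  let Y : List Bool × Bool × Bool → ℝ := fun τ => A τ.1 τ.2.1 * B τ.1 τ.2.2
  have hsum : ∀ (G : List Bool × Bool × Bool → Prop) [DecidablePred G],
      ∑ τ ∈ leaves P.CC, (if G τ then X τ else 0) =
        W * ∑ f, prob P.coins {r | G (P.trans f r, P.outA f r, P.outB f r)} := by
    intro G _
    simp only [P.prob_coins_eq_sum]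
    rw [sum_comm, mul_sum]
    refine sum_congr rfl fun τ _ => ?_
    split_ifs
    · rfl
    · simp
  have hacc : W * (W * (1 - α)) ≤ ∑ τ ∈ leaves P.CC, if τ.2.1 = τ.2.2 then X τ else 0 := by
    rw [hsum]
    refine mul_le_mul_of_nonneg_left ?_ hW.le
    have := sum_le_sum fun (f : S → R) (_ : f ∈ univ) => hK.accuracy f
    rwa [sum_const, card_univ, nsmul_eq_mul] at this
  have hsec : ∑ τ ∈ leaves P.CC, (if bestGuess A τ.1 = τ.2.1 then X τ else 0) ≤ W * (W * γ) := by
    rw [hsum]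
    refine mul_le_mul_of_nonneg_left ?_ hW.le
    have := hK.secrecy (fun t => OracleAlgorithm.answer (bestGuess A t)) fun t f => Nat.zero_le _
    rw [prob_indep_uniform, div_le_iff₀ hW] at this
    rw [mul_comm]
    exact this
  have hguess := sum_eq_le_sum_bestGuess P.CC A B fun t o => sum_nonneg fun f _ => prob_nonneg _ _
  -- The coefficient of `X τ - Y τ` is a difference of two indicators, hence -1, 0 or 1, and no
  -- factor 2 is lost.
  have hXY : ∀ τ ∈ leaves P.CC, ((if τ.2.1 = τ.2.2 then X τ else 0) -
      (if τ.2.1 = τ.2.2 then Y τ else 0)) + ((if bestGuess A τ.1 = τ.2.1 then Y τ else 0) -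
        (if bestGuess A τ.1 = τ.2.1 then X τ else 0)) ≤ |X τ - Y τ| := by
    intro τ _
    have h1 := le_abs_self (X τ - Y τ)
    have h2 := neg_abs_le (X τ - Y τ)
    have h3 := abs_nonneg (X τ - Y τ)
    split_ifs <;> linarith
  have htot := sum_le_sum hXY
  rw [sum_add_distrib, sum_sub_distrib, sum_sub_distrib] at htot
  have hY : ∀ τ, Y τ = (∑ f, P.probA f τ) * ∑ f, P.probB f τ := fun τ => rfl
  simp only [sum_probA_mul_probB_eq hA hB, sum_probA_mul_sum_probB_eq hA hB, ← hY]
  rw [Fintype.card_prod, Nat.cast_mul]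
  change W * W * (1 - α - γ) ≤ ∑ τ ∈ leaves P.CC, |X τ - Y τ|
  simp only [Y] at htot hguess ⊢
  linarith

theorem sq_mul_sq_div_le_max (hℓ : 0 < ℓ) (hα : 0 ≤ α) (hγ : 0 ≤ γ) (hαγ : α + γ < 1)
    (hP : P.IsUniformQuery D ℓ) (hK : P.IsKeyAgreement q α γ) :
    1 / 24576 * ((1 - α - γ) ^ 2 * (q : ℝ) ^ 2 / (ℓ : ℝ) ^ 3) ≤ max 1 (P.CC : ℝ) := by
  have hqD : q < D.card := by
    by_contra! h
    linarith [one_sub_le_of_card_le hP hK h]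
  have hqD' : (q : ℝ) ≤ D.card := by exact_mod_cast hqD.le
  have hq0 : (0 : ℝ) ≤ q := Nat.cast_nonneg q
  have hℓ' : (1 : ℝ) ≤ ℓ := by exact_mod_cast hℓ
  have hmax : 1 ≤ max 1 (P.CC : ℝ) := le_max_left _ _
  -- The entropy argument needs query density at most 1/2. Otherwise q < 2ℓ, and the left side is
  -- below 1. The constant is 24576 = 4 * 6144, the 4 coming from `log_card_leaves_le`.
  rcases le_or_gt (2 * ℓ) D.card with hD | hD
  · obtain ⟨hne, hA, hB⟩ := hP
    have hN : (0 : ℝ) < D.card := by exact_mod_cast (by omega : 0 < D.card)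
    have h1 := one_sub_sub_le_sum_abs_hybrid hA hB hK
    have h2 := sq_sum_abs_hybrid_sub_le
      (a := weight P.coinsA P.queriesA (D.card.choose ℓ) P.ConsA)
      (b := weight P.coinsB P.queriesB (D.card.choose ℓ) P.ConsB) hℓ hD
      (isLocal_weight (D.card.choose ℓ) fun f g r h => P.ConsA_congr h)
      (isLocal_weight (D.card.choose ℓ) fun f g r h => P.ConsB_congr h)
      (isWeight_weight hA) (isWeight_weight hB) (isNormalized_weight hA hB)
      (H := 4 * max 1 (P.CC : ℝ)) (by linarith) (log_card_leaves_le _)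
    have hW : (0 : ℝ) < Fintype.card ((S → R) × (S → R)) := Nat.cast_pos.2 Fintype.card_pos
    have h3 := (pow_le_pow_left₀ (mul_nonneg hW.le (by linarith)) h1 2).trans h2
    rw [mul_pow] at h3
    have h4 := le_of_mul_le_mul_left h3 (by positivity)
    rw [le_div_iff₀ (by positivity)] at h4
    have h5 : (1 - α - γ) ^ 2 * (q : ℝ) ^ 2 ≤ (1 - α - γ) ^ 2 * (D.card : ℝ) ^ 2 := by gcongr
    rw [one_div_mul_eq_div, div_div, div_le_iff₀ (by positivity)]
    linarith
  · have h1 : (q : ℝ) ≤ 2 * ℓ := by exact_mod_cast (by omega : q ≤ 2 * ℓ)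
    have h2 : (1 - α - γ) ^ 2 ≤ 1 := pow_le_one₀ (by linarith) (by linarith)
    have h3 : (1 - α - γ) ^ 2 * (q : ℝ) ^ 2 / (ℓ : ℝ) ^ 3 ≤ 4 := by
      rw [div_le_iff₀ (by positivity)]
      calc (1 - α - γ) ^ 2 * (q : ℝ) ^ 2 ≤ 1 * (2 * ℓ) ^ 2 := by gcongr
        _ = 4 * (ℓ : ℝ) ^ 2 * 1 := by ring
        _ ≤ 4 * (ℓ : ℝ) ^ 2 * ℓ := by gcongr
        _ = 4 * (ℓ : ℝ) ^ 3 := by ring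
    linarith

end Finite

end NonAdaptiveProtocol

end KeyAgreement

theorem mainTheorem2 :
    (∃ c : ℝ, 0 < c ∧
      ∀ (S : Type u₁) [Fintype S] [DecidableEq S] (R : Type u₂) [Fintype R] [Nonempty R]
        (ΩA : Type u₃) (ΩB : Type u₄)
        (P : KeyAgreement.NonAdaptiveProtocol S R ΩA ΩB) (D : Finset S)
        (ℓ q : ℕ) (α γ : ℝ), 0 < ℓ → 0 ≤ α → 0 ≤ γ → α + γ < 1 →
        P.IsUniformQuery D ℓ → P.IsKeyAgreement q α γ →
        c * ((1 - α - γ) ^ 4 * (q : ℝ) ^ 2 / (ℓ : ℝ) ^ 3) ≤ max 1 (P.CC : ℝ)) ∧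
    (∀ β δ : ℝ, 0 < β → 0 < δ → ∃ c : ℝ, 0 < c ∧ ∃ ℓ₀ : ℕ,
      ∀ (S : Type u₁) [Fintype S] [DecidableEq S] (R : Type u₂) [Fintype R] [Nonempty R]
        (ΩA : Type u₃) (ΩB : Type u₄)
        (P : KeyAgreement.NonAdaptiveProtocol S R ΩA ΩB) (D : Finset S)
        (ℓ q : ℕ) (α γ : ℝ), ℓ₀ ≤ ℓ → 0 ≤ α → 0 ≤ γ → δ ≤ 1 - α - γ →
        β * (ℓ : ℝ) ^ 2 ≤ (q : ℝ) →
        P.IsUniformQuery D ℓ → P.IsKeyAgreement q α γ →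
        c * (ℓ : ℝ) ≤ (P.CC : ℝ)) := by
  refine ⟨⟨1 / 24576, by norm_num, ?_⟩, ?_⟩
  · intro S _ _ R _ _ ΩA ΩB P D ℓ q α γ hℓ hα hγ hαγ hP hK
    refine le_trans ?_ (KeyAgreement.NonAdaptiveProtocol.sq_mul_sq_div_le_max hℓ hα hγ hαγ hP hK)
    have : (1 - α - γ) ^ 4 ≤ (1 - α - γ) ^ 2 :=
      pow_le_pow_of_le_one (by linarith) (by linarith) (by norm_num)
    gcongr
  · intro β δ hβ hδ
    set c : ℝ := 1 / 24576 * (δ ^ 2 * β ^ 2) with hc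
    have hc0 : 0 < c := by positivity
    -- For ℓ ≥ m one has c * ℓ > 1, so the maximum in the bound cannot be attained by 1 alone.
    obtain ⟨m, hm⟩ := exists_nat_gt (1 / c)
    refine ⟨c, hc0, m, ?_⟩
    intro S _ _ R _ _ ΩA ΩB P D ℓ q α γ hmℓ hα hγ hδ' hq hP hK
    have hℓm : 1 / c < (ℓ : ℝ) := hm.trans_le (by exact_mod_cast hmℓ)
    have hℓ' : (0 : ℝ) < ℓ := (by positivity : 0 < 1 / c).trans hℓm
    have h1 := KeyAgreement.NonAdaptiveProtocol.sq_mul_sq_div_le_max (by exact_mod_cast hℓ') hα hγ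
      (by linarith) hP hK
    have h2 : c * ℓ ≤ max 1 (P.CC : ℝ) := by
      refine le_trans ?_ h1
      have h3 : c * ℓ = 1 / 24576 * (δ ^ 2 * (β * (ℓ : ℝ) ^ 2) ^ 2 / (ℓ : ℝ) ^ 3) := by
        rw [hc]
        field_simp
      rw [h3]
      gcongr
    rcases le_max_iff.1 h2 with h | h
    · rw [div_lt_iff₀ hc0] at hℓm
      linarith
    · exact h
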